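/- Let $n\ge 0$ and let $P_n$ be the natural unit interval order on $[n]=\{1,\dots,n\}$ whose incomparability graph $\mathrm{inc}(P_n)$ is the path $1-2-\cdots-n$ (so $i<_{P_n}j$ if and only if $i+1<j$). For a graph $G$ on $[n]$ let $$X_G(\mathbf x,q)=\sum_{\kappa}q^{\#\{\{i,j\}\in E(G)\,:\,i<j,\ \kappa(i)>\kappa(j)\}}\,x_{\kappa(1)}\cdots x_{\kappa(n)},$$ the sum over all proper colorings $\kappa:[n]\to\mathbb Z_{>0}$ of $G$. Then there are unique polynomials $c_\lambda^{P_n}(q)\in\mathbb Z[q]$, $\lambda\vdash n$, with $$X_{\mathrm{inc}(P_n)}(\mathbf x,q)=\sum_{\lambda\vdash n}c^{P_n}_\lambda(q)\,e_\lambda(\mathbf x),$$ where $e_\lambda=e_{\lambda_1}e_{\lambda_2}\cdots$ are the elementary symmetric functions in infinitely many variables, and for every partition $\lambda\vdash n$ $$c_\lambda^{P_n}(q)=\sum_{T\in\mathrm{powST}_{P_n}(\lambda)}q^{\mathrm{inv}_{P_n}(T)}.$$ Here, for a poset $P$ on $[n]$: * A word $w_1\cdots w_k$ in $P$ is a *powersum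 word* if $w_i\not>_P w_{i+1}$ for all $i<k$ and the only position $i$ such that $w_i<_P w_j$ for all $j>i$ is $i=k$. * A *powerful array* of shape $\alpha=(\alpha_1,\dots,\alpha_l)$, a composition with positive parts, is a filling $A$ of the cells $\{(r,t):1\le r\le l,\ 1\le t\le\alpha_r\}$ with elements of $P$ such that each row is a powersum word, $A_{r,t}<_P A_{s,t}$ for all cells $(r,t),(s,t)$ with $r<s$, and $A_{r,\alpha_r}<_P A_{s,t}$ for all cells $(s,t)$ with $s>r$ and $t>\alpha_r$. Its image $\mathrm{tab}(A)$ is the filling of the Ferrers diagram of $\mathrm{sort}(\alpha)$ (the decreasing rearrangement of $\alpha$) obtained by pushing all entries of $A$ upward in their columns. * A *standard $P$-tableau* of shape $\lambda$ is a filling $T$ of the Ferrers diagram of $\lambda$ in which each element of $P$ occurs exactly once, with $T_{i,j}<_P T_{i+1,j}$ and $T_{i,j}\not>_P T_{i,j+1}$ wherever both cells exist. $\mathrm{powST}_P(\lambda)$ is the set of standard $P$-tableaux of shape $\lambda$ of the form $\mathrm{tab}(A)$, with $A$ a powerful array of some shape $\alpha$ with $\mathrm{sort}(\alpha)=\lambda$.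 * $\mathrm{inv}_P(T)$ is the number of pairs $i<j$ in $[n]$, incomparable in $P$, such that $i$ appears in $T$ in a column strictly to the right of the column of $j$. -/

import Mathlib

open Polynomial

noncomputable section

open scoped Classical in
/-- The inversion number `inv_G(κ) = #{{i,j} ∈ E(G) : i < j, κ(i) > κ(j)}` of a coloring `κ` of a
graph `G` on `[n]` (modelled by `Fin n`). -/
def colInv {n : ℕ} (G : SimpleGraph (Fin n)) (κ : Fin n → ℕ) : ℕ :=
  (Finset.univ.filter fun p : Fin n × Fin n => G.Adj p.1 p.2 ∧ p.1 < p.2 ∧ κ p.2 < κ p.1).card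

open scoped Classical in
/-- The chromatic quasisymmetric function
`X_G(x, q) = ∑_κ q^{inv_G(κ)} x_{κ(1)} ⋯ x_{κ(n)}`, the sum over all proper colorings `κ` of `G`,
as a formal power series over `ℤ[q]` in the variables `x_0, x_1, x_2, …` (the colors are the natural
numbers). Its coefficient at the monomial `x^d` is the sum of `q^{inv_G(κ)}` over the proper
colorings `κ` such that `x_{κ(1)} ⋯ x_{κ(n)} = x^d`; these take their values in the support
of `d`, so the sum is finite. -/
def chromaticQSym {n : ℕ} (G : SimpleGraph (Fin n)) : MvPowerSeries ℕ ℤ[X] := fun d =>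
  ∑ κ ∈ (Fintype.piFinset fun _ : Fin n => d.support).filter
      (fun κ : Fin n → ℕ =>
        (∀ u v, G.Adj u v → κ u ≠ κ v) ∧ ∑ v, Finsupp.single (κ v) 1 = d),
    (X : ℤ[X]) ^ colInv G κ

open scoped Classical in
/-- The elementary symmetric function `e_k = ∑_{i_1 < ⋯ < i_k} x_{i_1} ⋯ x_{i_k}` in infinitely many
variables: the sum of all square-free monomials of degree `k`. -/
def elemSymm (k : ℕ) : MvPowerSeries ℕ ℤ[X] := fun d =>
  if (∀ i, d i ≤ 1) ∧ d.degree = k then 1 else 0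

/-- `e_λ = e_{λ_1} e_{λ_2} ⋯`. -/
def elemSymmPart {n : ℕ} (lam : n.Partition) : MvPowerSeries ℕ ℤ[X] :=
  (lam.parts.map elemSymm).prod

/-- `F = ∑_{λ ⊢ n} c_λ(q) e_λ`. -/
def IsEExpansion {n : ℕ} (F : MvPowerSeries ℕ ℤ[X]) (c : n.Partition → ℤ[X]) : Prop :=
  F = ∑ lam : n.Partition, c lam • elemSymmPart lam

/-- A poset `P` on `[n]` is a natural unit interval order if there are reals `a_1 ≤ ⋯ ≤ a_n` with
`i <_P j ↔ a_i + 1 < a_j`. (The usual order of `[n]` is written through the values in `ℕ`, so that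
it cannot be confused with `P`.) -/
def IsNaturalUnitIntervalOrder {n : ℕ} (P : PartialOrder (Fin n)) : Prop :=
  ∃ a : Fin n → ℝ, (∀ i j : Fin n, i.val ≤ j.val → a i ≤ a j) ∧
    ∀ i j : Fin n, P.lt i j ↔ a i + 1 < a j

/-- The incomparability graph of a poset. -/
def incGraph {β : Type*} (P : PartialOrder β) : SimpleGraph β where
  Adj i j := i ≠ j ∧ ¬ P.lt i j ∧ ¬ P.lt j i
  symm := ⟨fun _ _ h => ⟨h.1.symm, h.2.2, h.2.1⟩⟩
  loopless := ⟨fun _ h => h.1 rfl⟩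

/-- A word with no `P`-descents: never `w_i >_P w_{i+1}`. -/
def NoDescents {β : Type*} (P : PartialOrder β) {k : ℕ} (w : Fin k → β) : Prop :=
  ∀ (i : ℕ) (h : i + 1 < k), ¬ P.lt (w ⟨i + 1, h⟩) (w ⟨i, Nat.lt_of_succ_lt h⟩)

/-- `w` has a right-left `P`-minimum in position `i`. -/
def IsRLMin {β : Type*} (P : PartialOrder β) {k : ℕ} (w : Fin k → β) (i : Fin k) : Prop :=
  ∀ j : Fin k, i.val < j.val → P.lt (w i) (w j)

/-- Powersum words: no `P`-descents, and no right-left `P`-minimum except in the last position. -/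
def IsPowersumWord {β : Type*} (P : PartialOrder β) {k : ℕ} (w : Fin k → β) : Prop :=
  NoDescents P w ∧ ∀ i : Fin k, IsRLMin P w i → i.val + 1 = k

/-- Fillings with entries in `β` of the left-justified diagram whose rows have, from top to bottom,
the lengths listed in `a`. Rows and columns are numbered from `0`. -/
abbrev Filling (a : List ℕ) (β : Type*) : Type _ := (r : Fin a.length) → Fin (a.get r) → β

/-- The cells `(r, t)` of the diagram with row lengths `a`. -/
abbrev DiagramCell (a : List ℕ) : Type := (r : Fin a.length) × Fin (a.get r)

/-- Powerful arrays of shape `α`. -/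
def IsPowerfulArray {β : Type*} (P : PartialOrder β) {m : ℕ} (α : Composition m)
    (A : Filling α.blocks β) : Prop :=
  -- each row is a powersum word
  (∀ r, IsPowersumWord P (A r)) ∧
  -- columns are increasing in `P`
  (∀ (r s : Fin α.blocks.length) (t : ℕ) (hr : t < α.blocks.get r) (hs : t < α.blocks.get s),
    r.val < s.val → P.lt (A r ⟨t, hr⟩) (A s ⟨t, hs⟩)) ∧
  -- the last entry of row `r` is below all entries further down and further to the right
  (∀ (r s : Fin α.blocks.length) (u : Fin (α.blocks.get r)) (t : Fin (α.blocks.get s)),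
    u.val + 1 = α.blocks.get r → r.val < s.val → α.blocks.get r ≤ t.val →
      P.lt (A r u) (A s t))

/-- The row lengths `λ_1 ≥ λ_2 ≥ ⋯` of the Ferrers diagram of a partition. -/
def rowLengths {m : ℕ} (lam : m.Partition) : List ℕ := lam.parts.sort (· ≥ ·)

/-- `P`-tableaux of shape `λ`: the columns are increasing in `P` and the rows have no
`P`-descents. -/
def IsPTableau {β : Type*} (P : PartialOrder β) {m : ℕ} (lam : m.Partition)
    (T : Filling (rowLengths lam) β) : Prop :=
  (∀ (r s : Fin (rowLengths lam).length) (t : ℕ) (hr : t < (rowLengths lam).get r)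
    (hs : t < (rowLengths lam).get s),
      r.val + 1 = s.val → P.lt (T r ⟨t, hr⟩) (T s ⟨t, hs⟩)) ∧
  ∀ r, NoDescents P (T r)

/-- A filling is bijective (standard) if each element of `β` occurs exactly once. -/
def IsStandard {β : Type*} {a : List ℕ} (T : Filling a β) : Prop :=
  Function.Bijective fun c : DiagramCell a => T c.1 c.2

open scoped Classical in
/-- The row to which the cell in row `r` and column `t` moves when all columns of the diagram are
pushed up: the number of cells above it in its column. -/
def pushedRow (a : List ℕ) (r : Fin a.length) (t : ℕ) : ℕ :=
  (Finset.univ.filter fun s : Fin a.length => s.val < r.val ∧ t < a.get s).card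

/-- `T = tab(A)`: the filling `T` of a diagram with row lengths `b` is obtained from the filling `A`
by pushing the entries upward in their columns. (Used only when `b` is the decreasing
rearrangement of `a`; then pushing up is a bijection between the cells, so `A` determines `T`.) -/
def IsTab {β : Type*} {a b : List ℕ} (A : Filling a β) (T : Filling b β) : Prop :=
  ∀ (r : Fin a.length) (t : Fin (a.get r)),
    ∃ (h : pushedRow a r t.val < b.length) (h' : t.val < b.get ⟨pushedRow a r t.val, h⟩),
      T ⟨pushedRow a r t.val, h⟩ ⟨t.val, h'⟩ = A r t

open scoped Classical in
/-- The set `powST_P(λ)` of standard powerful `P`-tableaux of shape `λ`: the standard `P`-tableaux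
of shape `λ` that are of the form `tab(A)`, for a powerful array `A` of a shape `α` with
`sort(α) = λ`. -/
def powST {n : ℕ} (P : PartialOrder (Fin n)) {m : ℕ} (lam : m.Partition) :
    Finset (Filling (rowLengths lam) (Fin n)) :=
  Finset.univ.filter fun T =>
    IsPTableau P lam T ∧ IsStandard T ∧
      ∃ (α : Composition m) (A : Filling α.blocks (Fin n)),
        Nat.Partition.ofComposition m α = lam ∧ IsPowerfulArray P α A ∧ IsTab A T

open scoped Classical in
/-- The inversion number of a standard filling: the number of pairs `i < j` of incomparable elements
such that `i` appears to the right of `j` (in a column further right). -/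
def tabInv {n : ℕ} (P : PartialOrder (Fin n)) {a : List ℕ} (T : Filling a (Fin n)) : ℕ :=
  (Finset.univ.filter fun p : DiagramCell a × DiagramCell a =>
    (T p.1.1 p.1.2).val < (T p.2.1 p.2.2).val ∧
    (incGraph P).Adj (T p.1.1 p.1.2) (T p.2.1 p.2.2) ∧
    p.2.2.val < p.1.2.val).card

end

noncomputable section

/-! Both sides are computed as sums over compositions. To a composition attach the product of
$[k]_q$ for its last part $k$ and $q[k-1]_q$ for every other part $k$ (`compWeight`). The claim is
that $c_\lambda$ and the tableau sum both equal the sum of these weights over the compositions that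
sort to $\lambda$.

Symmetric function side: a proper coloring of the path is a word whose adjacent letters differ, and
its inversions are the descents of the word. Let $W_n$ be the generating function of these words.
Consider pairs of an $i$-set and a word whose first letter lies outside the set, and absorb the
letters of the word into the set one at a time. This gives $W_{m+1}=[m+1]_q e_{m+1}+\sum_{j<m}
q[j]_q e_{j+1}W_{m-j}$ (`wordSum_succ_eq`), and unfolding it gives the sum over compositions.
Uniqueness is the linear independence of the $e_\lambda$, $\lambda\vdash n$, already in $n$
variables.

Tableau side: in the path order a powersum word with distinct letters is an interval written as
$0,\dots,p-1,k-1,\dots,p$ up to a shift (`exists_eq_rowWord`), and the rows of a standard powerful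
array are consecutive intervals. Such an array is thus a list of pairs $(k,p)$ with a compatibility
condition between each row and the rows below it. Record the column of each value $1,\dots,n$ as a
word: inversions of the tableau become descents, and the word determines both the tableau
(`eq_of_columnOf_eq`) and the list of pairs (`colWord_injective`). Summing over $p$ row by row gives
the composition weight (`sum_rowLists`). -/

/-- The number of descents of a word. -/
def descents : List ℕ → ℕ
  | a :: b :: l => (if b < a then 1 else 0) + descents (b :: l)
  | _ => 0

/-! ### Words with distinct adjacent letters: recurrence and elementary expansion -/

section Recurrence

variable {R : Type*} [CommRing R] (q : R) (x : ℕ → R)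

/-- The `q`-integer `1 + q + ⋯ + q ^ (n - 1)`. -/
def qInt (n : ℕ) : R := ∑ i ∈ Finset.range n, q ^ i

lemma qInt_succ (n : ℕ) : qInt q (n + 1) = qInt q n + q ^ n := Finset.sum_range_succ _ _

/-- The elementary symmetric polynomial in the values `x i`, `i ∈ s`. -/
def esymmOn (s : Finset ℕ) (k : ℕ) : R := ∑ S ∈ s.powersetCard k, ∏ i ∈ S, x i

/-- The weight of a word: zero if two adjacent letters agree, otherwise the monomial of the word
times `q` to the number of descents. -/
def wordWeight (l : List ℕ) : R :=
  if l.IsChain (· ≠ ·) then q ^ descents l * (l.map x).prod else 0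

/-- The sum of the weights of the words of length `n` in the alphabet `s`. -/
def wordSum (s : Finset ℕ) (n : ℕ) : R :=
  ∑ κ ∈ Fintype.piFinset fun _ : Fin n => s, wordWeight q x (List.ofFn κ)

/-- The sum of the weights of the words of length `m + 1` that start with `a`. -/
def startSum (s : Finset ℕ) (m a : ℕ) : R :=
  ∑ κ ∈ Fintype.piFinset fun _ : Fin m => s, wordWeight q x (a :: List.ofFn κ)

/-- The sum over pairs of a set `S` of size `i` and a word of length `m + 1` whose first letter
`a` is not in `S`, where the pair is weighted by the number of elements of `S` above `a`. -/
def insertSum (s : Finset ℕ) (i m : ℕ) : R :=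
  ∑ S ∈ s.powersetCard i, ∑ a ∈ s \ S,
    q ^ (S.filter (a < ·)).card * (∏ t ∈ S, x t) * startSum q x s m a

lemma sum_piFinset_ofFn_succ (s : Finset ℕ) (n : ℕ) (g : List ℕ → R) :
    ∑ κ ∈ Fintype.piFinset fun _ : Fin (n + 1) => s, g (List.ofFn κ) =
      ∑ a ∈ s, ∑ κ ∈ Fintype.piFinset fun _ : Fin n => s, g (a :: List.ofFn κ) := by
  rw [← Finset.sum_product']
  refine Finset.sum_nbij' (fun κ => (κ 0, Fin.tail κ)) (fun p => Fin.cons p.1 p.2) ?_ ?_ ?_ ?_ ?_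
  · intro κ hκ
    simp only [Fintype.mem_piFinset, Finset.mem_product] at hκ ⊢
    exact ⟨hκ 0, fun i => hκ i.succ⟩
  · rintro ⟨a, κ⟩ h
    simp only [Fintype.mem_piFinset, Finset.mem_product] at h ⊢
    exact fun i => Fin.cases h.1 h.2 i
  · intro κ _
    exact Fin.cons_self_tail κ
  · rintro ⟨a, κ⟩ _
    simp
  · intro κ _
    rw [List.ofFn_succ]
    rfl

lemma wordSum_zero (s : Finset ℕ) : wordSum q x s 0 = 1 := by
  simp [wordSum, wordWeight, descents]

lemma wordSum_succ (s : Finset ℕ) (n : ℕ) :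
    wordSum q x s (n + 1) = ∑ a ∈ s, startSum q x s n a :=
  sum_piFinset_ofFn_succ s n _

lemma startSum_zero (s : Finset ℕ) (a : ℕ) : startSum q x s 0 a = x a := by
  simp [startSum, wordWeight, descents]

lemma wordWeight_cons_cons (a b : ℕ) (l : List ℕ) :
    wordWeight q x (a :: b :: l) =
      (if a ≠ b then q ^ (if b < a then 1 else 0) else 0) * x a * wordWeight q x (b :: l) := by
  by_cases h : a = b <;> by_cases h' : (b :: l).IsChain (· ≠ ·)
  · simp [wordWeight, h]
  · simp [wordWeight, h]
  · simp only [wordWeight, List.isChain_cons_cons, h, h', ne_eq, not_false_eq_true, and_self,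
      if_true, descents, pow_add, List.map_cons, List.prod_cons]
    ring
  · simp only [wordWeight, List.isChain_cons_cons, h', and_false, if_false, mul_zero]

lemma startSum_succ (s : Finset ℕ) (m a : ℕ) :
    startSum q x s (m + 1) a = ∑ b ∈ s,
      (if a ≠ b then q ^ (if b < a then 1 else 0) else 0) * x a * startSum q x s m b := by
  rw [startSum, sum_piFinset_ofFn_succ s m fun l => wordWeight q x (a :: l)]
  refine Finset.sum_congr rfl fun b _ => ?_
  rw [startSum, Finset.mul_sum]
  exact Finset.sum_congr rfl fun κ _ => wordWeight_cons_cons q x a b _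

lemma sum_powersetCard_sdiff (s : Finset ℕ) (i : ℕ) (F : Finset ℕ → ℕ → R) :
    ∑ S ∈ s.powersetCard i, ∑ a ∈ s \ S, F S a =
      ∑ S ∈ s.powersetCard (i + 1), ∑ a ∈ S, F (S.erase a) a := by
  rw [Finset.sum_sigma', Finset.sum_sigma']
  refine Finset.sum_nbij' (fun p => ⟨insert p.2 p.1, p.2⟩) (fun p => ⟨p.1.erase p.2, p.2⟩)
    ?_ ?_ ?_ ?_ ?_
  · rintro ⟨S, a⟩ h
    simp only [Finset.mem_sigma, Finset.mem_powersetCard, Finset.mem_sdiff] at h ⊢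
    refine ⟨⟨Finset.insert_subset h.2.1 h.1.1, ?_⟩, Finset.mem_insert_self _ _⟩
    rw [Finset.card_insert_of_notMem h.2.2, h.1.2]
  · rintro ⟨S, a⟩ h
    simp only [Finset.mem_sigma, Finset.mem_powersetCard, Finset.mem_sdiff] at h ⊢
    refine ⟨⟨(Finset.erase_subset _ _).trans h.1.1, ?_⟩, h.1.1 h.2, Finset.notMem_erase _ _⟩
    rw [Finset.card_erase_of_mem h.2, h.1.2, Nat.add_sub_cancel]
  · rintro ⟨S, a⟩ h
    simp only [Finset.mem_sigma, Finset.mem_sdiff] at h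
    simp [Finset.erase_insert h.2.2]
  · rintro ⟨S, a⟩ h
    simp only [Finset.mem_sigma] at h
    simp [Finset.insert_erase h.2]
  · rintro ⟨S, a⟩ h
    simp only [Finset.mem_sigma, Finset.mem_sdiff] at h
    simp [Finset.erase_insert h.2.2]

lemma sum_pow_card_filter_lt (S : Finset ℕ) :
    ∑ a ∈ S, q ^ (S.filter (a < ·)).card = qInt q S.card := by
  induction S using Finset.induction_on_min with
  | empty => simp [qInt]
  | insert a S ha ih =>
    have haS : a ∉ S := fun h => (ha a h).false
    rw [Finset.sum_insert haS, Finset.card_insert_of_notMem haS, qInt_succ, ← ih, add_comm]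
    congr 1
    · refine Finset.sum_congr rfl fun b hb => ?_
      rw [Finset.filter_insert, if_neg (ha b hb).not_gt]
    · rw [Finset.filter_insert, if_neg (lt_irrefl a), Finset.filter_true_of_mem ha]

/-- Let $j$ elements of $S$ lie above $b$. They contribute the exponents $1,\dots,j$, and those
below $b$ contribute $j,\dots,|S|-1$ if $b\notin S$, but $j+1,\dots,|S|-1$ if $b\in S$. So the
exponents $1,\dots,|S|-1$ occur once each, with an extra $j$ when $b\notin S$. The summand $q^{|S|}$
on the left avoids $|S|-1$, which is wrong for empty $S$. -/
lemma sum_pow_card_filter_lt_add (S : Finset ℕ) (b : ℕ) :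
    ∑ a ∈ S, (q ^ (S.filter (a < ·)).card *
        if a ≠ b then q ^ (if b < a then 1 else 0) else 0) + q ^ S.card =
      q * qInt q S.card + if b ∈ S then 0 else q ^ (S.filter (b < ·)).card := by
  induction S using Finset.induction_on_min with
  | empty => simp [qInt]
  | insert a S ha ih =>
    have haS : a ∉ S := fun h => (ha a h).false
    have hsum : ∑ c ∈ S, (q ^ ((insert a S).filter (c < ·)).card *
        if c ≠ b then q ^ (if b < c then 1 else 0) else 0) =
        ∑ c ∈ S, (q ^ (S.filter (c < ·)).card *
          if c ≠ b then q ^ (if b < c then 1 else 0) else 0) := by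
      refine Finset.sum_congr rfl fun c hc => ?_
      rw [Finset.filter_insert, if_neg (ha c hc).not_gt]
    have hfil : (insert a S).filter (a < ·) = S := by
      rw [Finset.filter_insert, if_neg (lt_irrefl a), Finset.filter_true_of_mem ha]
    rw [Finset.sum_insert haS, hsum, hfil, Finset.card_insert_of_notMem haS, qInt_succ]
    rcases lt_trichotomy a b with h | rfl | h
    · have h1 : (insert a S).filter (b < ·) = S.filter (b < ·) := by
        rw [Finset.filter_insert, if_neg h.not_gt]
      rw [h1, if_pos h.ne, if_neg h.not_gt]
      simp only [Finset.mem_insert, h.ne', false_or]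
      linear_combination ih
    · rw [if_neg haS, Finset.filter_true_of_mem ha] at ih
      simp only [ne_eq, not_true_eq_false, if_false, Finset.mem_insert, true_or, if_true]
      linear_combination ih
    · have hS : ∀ c ∈ S, b < c := fun c hc => h.trans (ha c hc)
      have hb : b ∉ S := fun h => (hS b h).false
      rw [if_neg hb, Finset.filter_true_of_mem hS] at ih
      have h1 : (insert a S).filter (b < ·) = insert a S := by
        rw [Finset.filter_insert, if_pos h, Finset.filter_true_of_mem hS]
      rw [h1, if_pos h.ne', if_pos h, Finset.card_insert_of_notMem haS, if_neg (by simp [h.ne, hb])]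
      linear_combination ih

/-- The first letter $a$ moves into the set; since $a$ is not above itself, the exponent does not
change. -/
lemma insertSum_eq (s : Finset ℕ) (i m : ℕ) :
    insertSum q x s i m = ∑ S ∈ s.powersetCard (i + 1), ∑ a ∈ S,
      q ^ (S.filter (a < ·)).card * (∏ t ∈ S.erase a, x t) * startSum q x s m a := by
  rw [insertSum, sum_powersetCard_sdiff]
  refine Finset.sum_congr rfl fun S _ => Finset.sum_congr rfl fun a _ => ?_
  rw [Finset.filter_erase, Finset.erase_eq_of_notMem (by simp)]

lemma insertSum_zero_right (s : Finset ℕ) (i : ℕ) :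
    insertSum q x s i 0 = qInt q (i + 1) * esymmOn x s (i + 1) := by
  rw [insertSum_eq, esymmOn, Finset.mul_sum]
  refine Finset.sum_congr rfl fun S hS => ?_
  rw [← (Finset.mem_powersetCard.1 hS).2, ← sum_pow_card_filter_lt, Finset.sum_mul]
  refine Finset.sum_congr rfl fun a ha => ?_
  rw [startSum_zero, mul_assoc, Finset.prod_erase_mul _ _ ha]

/-- With the first letter $a$ absorbed into an $(i+1)$-set $S$, fix the second letter $b$ and sum
over $a\in S$. By `sum_pow_card_filter_lt_add` the result is $q[i]_q$, independent of $b$, plus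
$q^{\#\{t\in S:t>b\}}$ when $b\notin S$. The first part leaves $b$ free and factors; the second is
again a set with a word starting outside it. -/
lemma insertSum_succ (s : Finset ℕ) (i m : ℕ) :
    insertSum q x s i (m + 1) =
      q * qInt q i * esymmOn x s (i + 1) * wordSum q x s (m + 1) + insertSum q x s (i + 1) m := by
  have key : ∀ S ∈ s.powersetCard (i + 1), ∑ a ∈ S,
      q ^ (S.filter (a < ·)).card * (∏ t ∈ S.erase a, x t) * startSum q x s (m + 1) a =
      q * qInt q i * (∏ t ∈ S, x t) * wordSum q x s (m + 1) +
        ∑ b ∈ s \ S, q ^ (S.filter (b < ·)).card * (∏ t ∈ S, x t) * startSum q x s m b := by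
    intro S hS
    have hcard := (Finset.mem_powersetCard.1 hS).2
    calc _ = ∑ b ∈ s, (∑ a ∈ S, (q ^ (S.filter (a < ·)).card *
              if a ≠ b then q ^ (if b < a then 1 else 0) else 0)) *
              ((∏ t ∈ S, x t) * startSum q x s m b) := by
          simp_rw [startSum_succ, Finset.mul_sum, Finset.sum_mul]
          rw [Finset.sum_comm]
          refine Finset.sum_congr rfl fun b _ => Finset.sum_congr rfl fun a ha => ?_
          rw [← Finset.prod_erase_mul _ _ ha]
          ring
      _ = ∑ b ∈ s, (q * qInt q i + if b ∈ S then 0 else q ^ (S.filter (b < ·)).card) *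
              ((∏ t ∈ S, x t) * startSum q x s m b) := by
          refine Finset.sum_congr rfl fun b _ => ?_
          have h := sum_pow_card_filter_lt_add q S b
          rw [hcard, qInt_succ] at h
          congr 1
          linear_combination h
      _ = _ := by
          simp_rw [add_mul, Finset.sum_add_distrib]
          congr 1
          · rw [wordSum_succ, Finset.mul_sum]
            exact Finset.sum_congr rfl fun b _ => by ring
          · rw [← Finset.filter_notMem_eq_sdiff, Finset.sum_filter]
            refine Finset.sum_congr rfl fun b _ => ?_
            by_cases hb : b ∈ S <;> simp [hb, mul_assoc]
  rw [insertSum_eq, Finset.sum_congr rfl key, Finset.sum_add_distrib, insertSum, esymmOn,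
    Finset.mul_sum, Finset.sum_mul]

lemma insertSum_zero_left (s : Finset ℕ) (m : ℕ) :
    insertSum q x s 0 m = wordSum q x s (m + 1) := by
  simp [insertSum, wordSum_succ]

lemma insertSum_eq_sum (s : Finset ℕ) (i m : ℕ) :
    insertSum q x s i m = qInt q (i + m + 1) * esymmOn x s (i + m + 1) +
      ∑ j ∈ Finset.range m,
        q * qInt q (i + j) * esymmOn x s (i + j + 1) * wordSum q x s (m - j) := by
  induction m generalizing i with
  | zero => simp [insertSum_zero_right]
  | succ m ih =>
    rw [insertSum_succ, ih, Finset.sum_range_succ']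
    simp only [Nat.add_zero, Nat.sub_zero, Nat.add_sub_add_right, show ∀ j, i + 1 + j = i + (j + 1)
      from fun j => by omega]
    ring

/-- The recurrence for the weighted sum of all words in which adjacent letters differ. -/
lemma wordSum_succ_eq (s : Finset ℕ) (m : ℕ) :
    wordSum q x s (m + 1) = qInt q (m + 1) * esymmOn x s (m + 1) +
      ∑ j ∈ Finset.range m, q * qInt q j * esymmOn x s (j + 1) * wordSum q x s (m - j) := by
  simpa using (insertSum_zero_left q x s m).symm.trans (insertSum_eq_sum q x s 0 m)

/-- The coefficient attached to a composition in the elementary expansion. -/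
def compWeight : List ℕ → R
  | [] => 1
  | [k] => qInt q k
  | k :: l => q * qInt q (k - 1) * compWeight l

lemma compWeight_cons {l : List ℕ} (hl : l ≠ []) (k : ℕ) :
    compWeight q (k :: l) = q * qInt q (k - 1) * compWeight q l := by
  cases l with
  | nil => exact absurd rfl hl
  | cons a l => rfl

/-- The compositions of `n`, as lists. -/
def compLists (n : ℕ) : Finset (List ℕ) :=
  Finset.univ.image (Composition.blocks : Composition n → List ℕ)

lemma mem_compLists {n : ℕ} {l : List ℕ} : l ∈ compLists n ↔ (∀ i ∈ l, 0 < i) ∧ l.sum = n := by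
  simp only [compLists, Finset.mem_image, Finset.mem_univ, true_and]
  constructor
  · rintro ⟨c, rfl⟩
    exact ⟨fun i => c.blocks_pos, c.blocks_sum⟩
  · rintro ⟨h, h'⟩
    exact ⟨⟨l, fun {i} => h i, h'⟩, rfl⟩

lemma sum_compLists {n : ℕ} (f : List ℕ → R) :
    ∑ l ∈ compLists n, f l = ∑ c : Composition n, f c.blocks :=
  Finset.sum_image fun _ _ _ _ h => Composition.ext h

lemma sum_compLists_succ (m : ℕ) (f : List ℕ → R) :
    ∑ l ∈ compLists (m + 1), f l =
      ∑ j ∈ Finset.range (m + 1), ∑ l ∈ compLists (m - j), f ((j + 1) :: l) := by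
  rw [Finset.sum_sigma']
  refine Finset.sum_nbij' (fun l => ⟨l.headI - 1, l.tail⟩) (fun p => (p.1 + 1) :: p.2) ?_ ?_ ?_ ?_ ?_
  · intro l hl
    rw [mem_compLists] at hl
    cases l with
    | nil => simp at hl
    | cons a l =>
      simp only [List.mem_cons, forall_eq_or_imp, List.sum_cons] at hl
      simp only [Finset.mem_sigma, Finset.mem_range, mem_compLists, List.headI_cons, List.tail_cons]
      exact ⟨by omega, hl.1.2, by omega⟩
  · rintro ⟨j, l⟩ h
    simp only [Finset.mem_sigma, Finset.mem_range, mem_compLists] at h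
    simp only [mem_compLists, List.mem_cons, forall_eq_or_imp, List.sum_cons]
    exact ⟨⟨by omega, h.2.1⟩, by omega⟩
  · intro l hl
    rw [mem_compLists] at hl
    cases l with
    | nil => simp at hl
    | cons a l =>
      have := hl.1 a (by simp)
      simp [Nat.sub_add_cancel this]
  · rintro ⟨j, l⟩ _
    simp
  · intro l hl
    rw [mem_compLists] at hl
    cases l with
    | nil => simp at hl
    | cons a l =>
      have := hl.1 a (by simp)
      simp [Nat.sub_add_cancel this]

lemma compLists_zero : compLists 0 = {[]} := by
  ext l
  rw [mem_compLists, Finset.mem_singleton]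
  constructor
  · rintro ⟨h, h'⟩
    cases l with
    | nil => rfl
    | cons a l => have := h a (by simp); simp at h'; omega
  · rintro rfl
    simp

/-- The elementary expansion of the weighted sum of all words in which adjacent letters differ. -/
lemma wordSum_eq_sum_compLists (s : Finset ℕ) (n : ℕ) :
    wordSum q x s n = ∑ l ∈ compLists n, compWeight q l * (l.map (esymmOn x s)).prod := by
  induction n using Nat.strong_induction_on with
  | _ n ih =>
  cases n with
  | zero => simp [compLists_zero, wordSum_zero, compWeight]
  | succ m =>
    rw [wordSum_succ_eq, sum_compLists_succ, Finset.sum_range_succ, add_comm]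
    congr 1
    · refine Finset.sum_congr rfl fun j hj => ?_
      rw [Finset.mem_range] at hj
      rw [ih _ (by omega), Finset.mul_sum]
      refine Finset.sum_congr rfl fun l hl => ?_
      have hl' : l ≠ [] := by
        rintro rfl
        have := (mem_compLists.1 hl).2
        simp at this
        omega
      rw [compWeight_cons q hl', List.map_cons, List.prod_cons, Nat.add_sub_cancel]
      ring
    -- The term $j=m$: nothing follows the first part, so it has the weight of a last part.
    · simp [compLists_zero, compWeight]

end Recurrence

/-! ### The path order, and colorings of the path as words -/

lemma path_lt_iff {n : ℕ} {P : PartialOrder (Fin n)} (hP : IsNaturalUnitIntervalOrder P)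
    (hpath : incGraph P = SimpleGraph.pathGraph n) (i j : Fin n) :
    P.lt i j ↔ i.val + 1 < j.val := by
  obtain ⟨a, ha, hlt⟩ := hP
  -- The incomparability graph only tells which pairs are comparable; the monotone real
  -- representation gives their direction.
  have hval : ∀ i j : Fin n, P.lt i j → i.val < j.val := by
    intro i j h
    by_contra! hji
    have h1 := ha j i hji
    have h2 := (hlt i j).1 h
    linarith
  have hadj : ∀ i j : Fin n, (i ≠ j ∧ ¬ P.lt i j ∧ ¬ P.lt j i) ↔
      (i.val + 1 = j.val ∨ j.val + 1 = i.val) := by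
    intro i j
    rw [← SimpleGraph.pathGraph_adj, ← hpath]
    rfl
  constructor
  · intro h
    have h1 := hval i j h
    have h2 : ¬ (i.val + 1 = j.val) := fun h3 => ((hadj i j).2 (Or.inl h3)).2.1 h
    exact lt_of_le_of_ne h1 h2
  · intro h
    by_contra hn
    have h1 := (hadj i j).1 ⟨fun h2 => by subst h2; clear hn; omega, hn,
      fun h2 => by have := hval j i h2; clear hn h2; omega⟩
    clear hn
    omega

lemma card_filter_descent {n : ℕ} (c : Fin n → ℕ) :
    (Finset.univ.filter fun p : Fin n × Fin n =>
      p.1.val + 1 = p.2.val ∧ c p.2 < c p.1).card = descents (List.ofFn c) := by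
  rw [Finset.card_filter, ← Finset.univ_product_univ, Finset.sum_product]
  induction n with
  | zero => simp [descents]
  | succ n ih =>
    rw [Fin.sum_univ_succ]
    have h1 : ∀ i : Fin n, (∑ j : Fin (n + 1),
        if (i.succ.val + 1 = j.val ∧ c j < c i.succ) then 1 else 0) =
        ∑ j : Fin n, if (i.val + 1 = j.val ∧ c j.succ < c i.succ) then 1 else 0 := by
      intro i
      rw [Fin.sum_univ_succ]
      simp
    simp only [h1]
    rw [ih fun i => c i.succ, List.ofFn_succ]
    cases n with
    | zero => simp [descents]
    | succ n =>
      rw [List.ofFn_succ, descents, Fin.sum_univ_succ, Fin.sum_univ_succ]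
      simp
      rfl

lemma isChain_ofFn_iff {n : ℕ} (c : Fin n → ℕ) :
    (∀ u v, (SimpleGraph.pathGraph n).Adj u v → c u ≠ c v) ↔
      (List.ofFn c).IsChain (· ≠ ·) := by
  simp only [SimpleGraph.pathGraph_adj, List.isChain_iff_getElem, List.length_ofFn,
    List.getElem_ofFn]
  constructor
  · exact fun h i hi => h ⟨i, by omega⟩ ⟨i + 1, hi⟩ (Or.inl rfl)
  · rintro h u v (huv | huv)
    · have := h u (by omega)
      convert this
      exact huv.symm
    · have := h v (by omega)
      rw [ne_comm]
      convert this
      exact huv.symm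

lemma colInv_pathGraph {n : ℕ} (κ : Fin n → ℕ) :
    colInv (SimpleGraph.pathGraph n) κ = descents (List.ofFn κ) := by
  rw [colInv, ← card_filter_descent]
  congr 1
  ext p
  simp only [Finset.mem_filter, Finset.mem_univ, true_and, SimpleGraph.pathGraph_adj, Fin.lt_def]
  constructor
  · exact fun h => ⟨by omega, h.2.2⟩
  · exact fun h => ⟨Or.inl h.1, by omega, h.2⟩

/-! ### From power series in infinitely many variables to polynomials -/

/-- A power series and a polynomial that agree after all variables outside `s` are set to zero. -/
def AgreeOn {A : Type*} [CommRing A] (s : Finset ℕ) (F : MvPowerSeries ℕ A)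
    (p : MvPolynomial ℕ A) : Prop :=
  ∀ d : ℕ →₀ ℕ, d.support ⊆ s → MvPowerSeries.coeff d F = p.coeff d

namespace AgreeOn

variable {A : Type*} [CommRing A] {s : Finset ℕ} {F G : MvPowerSeries ℕ A}
  {p r : MvPolynomial ℕ A}

lemma one : AgreeOn s (1 : MvPowerSeries ℕ A) 1 := by
  intro d _
  rw [MvPowerSeries.coeff_one, MvPolynomial.coeff_one]
  simp only [eq_comm]

lemma mul (hF : AgreeOn s F p) (hG : AgreeOn s G r) : AgreeOn s (F * G) (p * r) := by
  intro d hd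
  rw [MvPowerSeries.coeff_mul, MvPolynomial.coeff_mul]
  refine Finset.sum_congr rfl fun e he => ?_
  replace he := Finset.HasAntidiagonal.mem_antidiagonal.1 he
  have h1 : e.1 ≤ d := he ▸ le_self_add
  have h2 : e.2 ≤ d := he ▸ le_add_self
  rw [hF _ ((Finsupp.support_mono h1).trans hd), hG _ ((Finsupp.support_mono h2).trans hd)]

lemma smul (c : A) (hF : AgreeOn s F p) : AgreeOn s (c • F) (c • p) := by
  intro d hd
  rw [MvPowerSeries.coeff_smul, MvPolynomial.coeff_smul, hF d hd, smul_eq_mul]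

lemma sum {ι : Type*} (t : Finset ι) {F : ι → MvPowerSeries ℕ A} {p : ι → MvPolynomial ℕ A}
    (h : ∀ i ∈ t, AgreeOn s (F i) (p i)) : AgreeOn s (∑ i ∈ t, F i) (∑ i ∈ t, p i) := by
  intro d hd
  rw [map_sum, MvPolynomial.coeff_sum]
  exact Finset.sum_congr rfl fun i hi => h i hi d hd

lemma list_prod {ι : Type*} (l : List ι) {F : ι → MvPowerSeries ℕ A} {p : ι → MvPolynomial ℕ A}
    (h : ∀ i, AgreeOn s (F i) (p i)) : AgreeOn s (l.map F).prod (l.map p).prod := by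
  induction l with
  | nil => exact one
  | cons a l ih => simpa using (h a).mul ih

lemma multiset_prod {ι : Type*} (l : Multiset ι) {F : ι → MvPowerSeries ℕ A}
    {p : ι → MvPolynomial ℕ A} (h : ∀ i, AgreeOn s (F i) (p i)) :
    AgreeOn s (l.map F).prod (l.map p).prod := by
  induction l using Quotient.inductionOn with
  | h l => simpa using list_prod l h

end AgreeOn

lemma agreeOn_elemSymm (s : Finset ℕ) (k : ℕ) :
    AgreeOn s (elemSymm k) (esymmOn (MvPolynomial.X : ℕ → MvPolynomial ℕ ℤ[X]) s k) := by
  classical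
  intro d hd
  have hprod : ∀ S : Finset ℕ, ∏ i ∈ S, (MvPolynomial.X i : MvPolynomial ℕ ℤ[X]) =
      MvPolynomial.monomial (∑ i ∈ S, Finsupp.single i 1) 1 := by
    intro S
    rw [MvPolynomial.monomial_sum_one]
    rfl
  have hind : ∀ (S : Finset ℕ) (j : ℕ), (∑ i ∈ S, Finsupp.single i 1 : ℕ →₀ ℕ) j =
      if j ∈ S then 1 else 0 := by
    intro S j
    rw [Finsupp.finsetSum_apply]
    simp [Finsupp.single_apply]
  have heq : ∀ S : Finset ℕ, (∑ i ∈ S, Finsupp.single i 1 : ℕ →₀ ℕ) = d ↔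
      ((∀ i, d i ≤ 1) ∧ S = d.support) := by
    intro S
    constructor
    · rintro rfl
      refine ⟨fun i => ?_, ?_⟩
      · rw [hind]; split_ifs <;> simp
      · ext i
        rw [Finsupp.mem_support_iff, hind]
        simp
    · rintro ⟨h, rfl⟩
      ext j
      rw [hind]
      have := h j
      by_cases hj : d j = 0
      · simp [hj]
      · simp [hj]; omega
  rw [esymmOn, MvPolynomial.coeff_sum]
  simp only [hprod, MvPolynomial.coeff_monomial, heq]
  change (if (∀ i, d i ≤ 1) ∧ d.degree = k then (1 : ℤ[X]) else 0) = _
  by_cases h : ∀ i, d i ≤ 1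
  · have hdeg : d.degree = d.support.card := by
      rw [Finsupp.degree_apply, Finset.card_eq_sum_ones]
      refine Finset.sum_congr rfl fun i hi => ?_
      have := h i
      have := Finsupp.mem_support_iff.1 hi
      omega
    simp [h, hdeg, Finset.sum_ite_eq', Finset.mem_powersetCard, hd]
  · simp [h]

/-- Every coloring with monomial $x^d$ takes its colors in the support of $d$, so enlarging the
alphabet to $s$ does not change the coefficient. -/
lemma agreeOn_chromaticQSym (s : Finset ℕ) (n : ℕ) :
    AgreeOn s (chromaticQSym (SimpleGraph.pathGraph n))
      (wordSum (MvPolynomial.C X) (MvPolynomial.X : ℕ → MvPolynomial ℕ ℤ[X]) s n) := by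
  classical
  intro d hd
  have hcoeff : ∀ κ : Fin n → ℕ,
      (wordWeight (MvPolynomial.C X) (MvPolynomial.X : ℕ → MvPolynomial ℕ ℤ[X])
        (List.ofFn κ)).coeff d =
      if (∀ u v, (SimpleGraph.pathGraph n).Adj u v → κ u ≠ κ v) ∧
        ∑ v, Finsupp.single (κ v) 1 = d then
        (X : ℤ[X]) ^ colInv (SimpleGraph.pathGraph n) κ else 0 := by
    intro κ
    have hprod : ((List.ofFn κ).map (MvPolynomial.X : ℕ → MvPolynomial ℕ ℤ[X])).prod =
        MvPolynomial.monomial (∑ v, Finsupp.single (κ v) 1) 1 := by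
      rw [MvPolynomial.monomial_sum_one, List.map_ofFn, List.prod_ofFn]
      rfl
    simp only [isChain_ofFn_iff]
    rw [wordWeight, hprod, ← colInv_pathGraph, ← map_pow]
    by_cases h : (List.ofFn κ).IsChain (· ≠ ·)
    · simp only [h, if_true, true_and, MvPolynomial.coeff_C_mul, MvPolynomial.coeff_monomial]
      split_ifs <;> simp
    · simp [h]
  rw [wordSum, MvPolynomial.coeff_sum]
  simp only [hcoeff]
  rw [← Finset.sum_filter]
  change (∑ κ ∈ _, _) = _
  refine Finset.sum_congr ?_ fun _ _ => rfl
  ext κ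
  simp only [Finset.mem_filter, Fintype.mem_piFinset]
  refine ⟨fun h => ⟨fun v => hd (h.1 v), h.2⟩, fun h => ⟨fun v => ?_, h.2⟩⟩
  rw [← h.2.2, Finsupp.mem_support_iff, Finsupp.finsetSum_apply]
  intro h0
  have := (Finset.sum_eq_zero_iff.1 h0) v (Finset.mem_univ v)
  simp at this

lemma isEExpansion_pathGraph (n : ℕ) : IsEExpansion (chromaticQSym (SimpleGraph.pathGraph n))
    fun lam => ∑ c : Composition n with Nat.Partition.ofComposition n c = lam,
      compWeight (X : ℤ[X]) c.blocks := by
  have hC : ∀ l : List ℕ, compWeight (MvPolynomial.C X : MvPolynomial ℕ ℤ[X]) l =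
      MvPolynomial.C (compWeight X l) := by
    intro l
    induction l with
    | nil => simp [compWeight]
    | cons k l ih =>
      cases l with
      | nil => simp [compWeight, qInt]
      | cons a l =>
        rw [compWeight_cons _ (List.cons_ne_nil a l), compWeight_cons _ (List.cons_ne_nil a l), ih]
        simp [qInt]
  have hpart : ∀ lam : n.Partition, (∑ c : Composition n with
      Nat.Partition.ofComposition n c = lam, compWeight (X : ℤ[X]) c.blocks) •
        elemSymmPart lam = ∑ c : Composition n with Nat.Partition.ofComposition n c = lam,
          compWeight (X : ℤ[X]) c.blocks • (c.blocks.map elemSymm).prod := by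
    intro lam
    rw [Finset.sum_smul]
    refine Finset.sum_congr rfl fun c hc => ?_
    rw [← (Finset.mem_filter.1 hc).2, elemSymmPart, Nat.Partition.ofComposition,
      Multiset.map_coe, Multiset.prod_coe]
  rw [IsEExpansion]
  simp only [hpart]
  rw [Finset.sum_fiberwise]
  ext1 d
  -- The coefficient at $x^d$ only sees the variables in the support of $d$, so the word identity
  -- over this finite alphabet suffices.
  have h1 := agreeOn_chromaticQSym d.support n d subset_rfl
  have h2 : AgreeOn d.support
      (∑ c : Composition n, compWeight (X : ℤ[X]) c.blocks • (c.blocks.map elemSymm).prod)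
      (∑ c : Composition n, compWeight (X : ℤ[X]) c.blocks •
        (c.blocks.map (esymmOn MvPolynomial.X d.support)).prod) :=
    AgreeOn.sum _ fun c _ => (AgreeOn.list_prod _ fun k => agreeOn_elemSymm _ k).smul _
  rw [h1, h2 d subset_rfl, wordSum_eq_sum_compLists, sum_compLists]
  simp only [hC, MvPolynomial.smul_eq_C_mul]

/-! ### Uniqueness of the elementary expansion -/

lemma aeval_esymm_injective (A : Type*) [CommRing A] (n : ℕ) : Function.Injective
    (MvPolynomial.aeval fun i : Fin n => MvPolynomial.esymm (Fin n) A (i + 1) :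
      MvPolynomial (Fin n) A →ₐ[A] MvPolynomial (Fin n) A) := by
  intro p r h
  apply MvPolynomial.esymmAlgHom_injective (σ := Fin n) A (by simp)
  apply Subtype.ext
  exact (MvPolynomial.esymmAlgHom_apply p).trans (h.trans (MvPolynomial.esymmAlgHom_apply r).symm)

/-- The polynomials `e_λ` in `n` variables, `λ ⊢ n`, are linearly independent. -/
lemma linearIndependent_esymmPart (A : Type*) [CommRing A] (n : ℕ) :
    LinearIndependent A fun lam : n.Partition => MvPolynomial.esymmPart (Fin n) A lam := by
  have hle : ∀ (lam : n.Partition), ∀ i ∈ lam.parts, i - 1 < n := by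
    intro lam i hi
    have h1 := lam.parts_pos hi
    have h2 := Multiset.le_sum_of_mem hi
    rw [lam.parts_sum] at h2
    omega
  -- The multiplicities of the parts: $e_\lambda$ is the monomial with exponent `e lam` in the
  -- algebraically independent $e_1,\dots,e_n$, and distinct partitions give distinct monomials.
  let e : n.Partition → (Fin n →₀ ℕ) := fun lam =>
    Finsupp.equivFunOnFinite.symm fun i => lam.parts.count (i.val + 1)
  have he : Function.Injective e := by
    intro lam mu h
    ext i
    have h' := fun j => DFunLike.congr_fun h j
    by_cases hi : 0 < i ∧ i - 1 < n
    · have := h' ⟨i - 1, hi.2⟩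
      simpa [e, Nat.sub_add_cancel hi.1] using this
    · have : ∀ nu : n.Partition, nu.parts.count i = 0 := fun nu =>
        Multiset.count_eq_zero.2 fun hmem => hi ⟨nu.parts_pos hmem, hle nu i hmem⟩
      rw [this, this]
  have hmap : ∀ lam, MvPolynomial.esymmPart (Fin n) A lam =
      (MvPolynomial.aeval fun i : Fin n => MvPolynomial.esymm (Fin n) A (i + 1))
        (MvPolynomial.monomial (e lam) (1 : A)) := by
    intro lam
    rw [MvPolynomial.aeval_monomial, map_one, one_mul, Finsupp.prod_fintype _ _ (by simp),
      MvPolynomial.esymmPart, Finset.prod_multiset_map_count]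
    symm
    refine Finset.prod_bij_ne_one (fun i _ _ => i.val + 1) ?_ ?_ ?_ ?_
    · intro i _ h
      rw [Multiset.mem_toFinset]
      by_contra hc
      exact h (by simp [e, Multiset.count_eq_zero.2 hc])
    · intro i _ _ j _ _ h
      exact Fin.ext (by omega)
    · intro k hk _
      rw [Multiset.mem_toFinset] at hk
      have := lam.parts_pos hk
      refine ⟨⟨k - 1, hle lam k hk⟩, Finset.mem_univ _, ?_, by simp; omega⟩
      simpa [e, Nat.sub_add_cancel this]
    · intro i _ _
      simp [e]
  have hli : LinearIndependent A fun lam : n.Partition =>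
      (MvPolynomial.monomial (e lam) (1 : A)) := by
    have := (MvPolynomial.basisMonomials (Fin n) A).linearIndependent.comp e he
    simpa [Function.comp_def] using this
  simp only [hmap]
  exact hli.map' (AlgHom.toLinearMap (MvPolynomial.aeval fun i : Fin n =>
    MvPolynomial.esymm (Fin n) A (i + 1))) (LinearMap.ker_eq_bot.2 (aeval_esymm_injective A n))

/-- Restricting to $n$ variables loses nothing: the parts of $\lambda\vdash n$ are at most $n$, so
the $e_\lambda$ stay independent. -/
lemma IsEExpansion.unique {n : ℕ} {F : MvPowerSeries ℕ ℤ[X]} {c c' : n.Partition → ℤ[X]}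
    (h : IsEExpansion F c) (h' : IsEExpansion F c') : c = c' := by
  let s : Finset ℕ := Finset.range n
  have hag : ∀ c : n.Partition → ℤ[X], IsEExpansion F c → AgreeOn s F
      (MvPolynomial.rename Fin.val
        (∑ lam, c lam • MvPolynomial.esymmPart (Fin n) ℤ[X] lam)) := by
    intro c hc
    have hes : ∀ k, MvPolynomial.rename Fin.val (MvPolynomial.esymm (Fin n) ℤ[X] k) =
        esymmOn MvPolynomial.X s k := by
      intro k
      have hs : s = Finset.univ.map (Fin.valEmbedding : Fin n ↪ ℕ) := by
        ext i
        simp [s]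
      rw [MvPolynomial.esymm, esymmOn, map_sum, hs, Finset.powersetCard_map, Finset.sum_map]
      refine Finset.sum_congr rfl fun S _ => ?_
      simp [map_prod]
    rw [hc, map_sum]
    refine AgreeOn.sum _ fun lam _ => ?_
    rw [map_smul]
    refine AgreeOn.smul _ ?_
    rw [MvPolynomial.esymmPart, map_multiset_prod, Multiset.map_map]
    exact AgreeOn.multiset_prod _ fun k => by
      rw [Function.comp_apply, hes]
      exact agreeOn_elemSymm s k
  have heq : MvPolynomial.rename Fin.val
      (∑ lam, c lam • MvPolynomial.esymmPart (Fin n) ℤ[X] lam) =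
      MvPolynomial.rename Fin.val
        (∑ lam, c' lam • MvPolynomial.esymmPart (Fin n) ℤ[X] lam) := by
    ext1 d
    by_cases hd : d.support ⊆ s
    · rw [← hag c h d hd, hag c' h' d hd]
    · have hz : ∀ p : MvPolynomial (Fin n) ℤ[X], (MvPolynomial.rename Fin.val p).coeff d = 0 := by
        intro p
        refine MvPolynomial.coeff_rename_eq_zero _ _ _ fun u hu => ?_
        exfalso
        apply hd
        rw [← hu]
        intro i hi
        have := Finsupp.mapDomain_support hi
        simp only [Finset.mem_image] at this
        obtain ⟨j, _, rfl⟩ := this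
        simp [s]
      rw [hz, hz]
  have h2 := MvPolynomial.rename_injective _ Fin.val_injective heq
  have h3 := (linearIndependent_esymmPart ℤ[X] n)
  rw [← sub_eq_zero, ← Finset.sum_sub_distrib] at h2
  simp only [← sub_smul] at h2
  exact funext fun lam => sub_eq_zero.1 (Fintype.linearIndependent_iff.1 h3 _ h2 lam)

/-! ### Lists of pairs encoding arrays, and their column words -/

/-- The word `0, 1, …, p - 1, k - 1, k - 2, …, p`. It is its own inverse as a permutation. -/
def rowWord (k p t : ℕ) : ℕ := if t < p then t else k - 1 - (t - p)

lemma rowWord_lt {k p t : ℕ} (hp : p < k) : rowWord k p t < k := by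
  unfold rowWord; split_ifs <;> omega

lemma rowWord_rowWord {k p t : ℕ} (hp : p < k) (ht : t < k) :
    rowWord k p (rowWord k p t) = t := by
  unfold rowWord; split_ifs <;> omega

/-- A list of pairs `(k, p)` stands for the array whose rows are the words `rowWord k p`, shifted so
that their values are consecutive intervals. The column word lists the column of each value. -/
def colWord : List (ℕ × ℕ) → List ℕ
  | [] => []
  | (k, p) :: L => (List.range k).map (rowWord k p) ++ colWord L

/-- The condition on a row of type `(k, p)` and on the column word `w` of the rows below it. -/
def Compat (k p : ℕ) (w : List ℕ) : Prop :=
  ∀ c ∈ w.head?, c ≠ p ∧ ¬ (p + 1 = k ∧ k ≤ c)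

open scoped Classical in
/-- The lists of pairs with first entries `a` that stand for powerful arrays. -/
def rowLists : List ℕ → Finset (List (ℕ × ℕ))
  | [] => {[]}
  | k :: a => ((rowLists a ×ˢ Finset.range k).filter fun y => Compat k y.2 (colWord y.1)).image
      fun y => (k, y.2) :: y.1

lemma mem_rowLists_nil {L : List (ℕ × ℕ)} : L ∈ rowLists [] ↔ L = [] := by
  simp [rowLists]

lemma mem_rowLists_cons {k : ℕ} {a : List ℕ} {L : List (ℕ × ℕ)} :
    L ∈ rowLists (k :: a) ↔
      ∃ p L', L = (k, p) :: L' ∧ p < k ∧ L' ∈ rowLists a ∧ Compat k p (colWord L') := by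
  simp only [rowLists, Finset.mem_image, Finset.mem_filter, Finset.mem_product, Finset.mem_range,
    Prod.exists]
  constructor
  · rintro ⟨L', p, ⟨⟨h1, h2⟩, h3⟩, rfl⟩
    exact ⟨p, L', rfl, h2, h1, h3⟩
  · rintro ⟨p, L', rfl, h2, h1, h3⟩
    exact ⟨L', p, ⟨⟨h1, h2⟩, h3⟩, rfl⟩

lemma map_fst_of_mem_rowLists {a : List ℕ} {L : List (ℕ × ℕ)} (h : L ∈ rowLists a) :
    L.map Prod.fst = a := by
  induction a generalizing L with
  | nil => simp [mem_rowLists_nil.1 h]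
  | cons k a ih =>
    obtain ⟨p, L', rfl, _, h', _⟩ := mem_rowLists_cons.1 h
    simp [ih h']

lemma length_colWord {a : List ℕ} {L : List (ℕ × ℕ)} (h : L ∈ rowLists a) :
    (colWord L).length = a.sum := by
  induction a generalizing L with
  | nil => simp [mem_rowLists_nil.1 h, colWord]
  | cons k a ih =>
    obtain ⟨p, L', rfl, _, h', _⟩ := mem_rowLists_cons.1 h
    simp [colWord, ih h']

lemma colWord_ne_nil {k : ℕ} {a : List ℕ} {L : List (ℕ × ℕ)} (h : L ∈ rowLists (k :: a)) :
    colWord L ≠ [] := by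
  obtain ⟨p, L', rfl, hp, _, _⟩ := mem_rowLists_cons.1 h
  intro h0
  have := congrArg List.length h0
  simp [colWord] at this
  omega

lemma getElem?_row_append_of_lt {k p i : ℕ} (hi : i < k) (w : List ℕ) :
    ((List.range k).map (rowWord k p) ++ w)[i]? = some (rowWord k p i) := by
  rw [List.getElem?_append_left (by simpa)]
  simp [hi]

lemma getElem?_row_append_add (k p i : ℕ) (w : List ℕ) :
    ((List.range k).map (rowWord k p) ++ w)[k + i]? = w[i]? := by
  rw [List.getElem?_append_right (by simp)]
  simp

lemma descents_append_cons_cons (l : List ℕ) (d c : ℕ) (w : List ℕ) :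
    descents (l ++ d :: c :: w) =
      descents (l ++ [d]) + (if c < d then 1 else 0) + descents (c :: w) := by
  induction l with
  | nil => simp [descents]
  | cons a l ih =>
    cases l with
    | nil => simp [descents]; omega
    | cons b l =>
      simp only [List.cons_append, descents] at ih ⊢
      omega

lemma descents_map_range' (f : ℕ → ℕ) (s k : ℕ) : descents ((List.range' s (k + 1)).map f) =
    ∑ i ∈ Finset.range k, if f (s + i + 1) < f (s + i) then 1 else 0 := by
  induction k generalizing s with
  | zero => simp [descents]
  | succ k ih =>
    have := ih (s + 1)
    rw [Finset.sum_range_succ']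
    simp only [List.range'_succ, List.map_cons, descents] at this ⊢
    rw [this]
    simp only [show ∀ i, s + 1 + i = s + (i + 1) from fun i => by omega, Nat.add_zero]
    omega

lemma descents_row {k p : ℕ} (hp : p < k) :
    descents ((List.range k).map (rowWord k p)) = k - 1 - p := by
  obtain ⟨k, rfl⟩ : ∃ j, k = j + 1 := ⟨k - 1, by omega⟩
  rw [List.range_eq_range', descents_map_range', ← Finset.card_filter]
  have : (Finset.range k).filter
      (fun i => rowWord (k + 1) p (0 + i + 1) < rowWord (k + 1) p (0 + i)) = Finset.Ico p k := by
    ext i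
    rw [Finset.mem_filter, Finset.mem_range, Finset.mem_Ico]
    unfold rowWord
    split_ifs <;> omega
  rw [this, Nat.card_Ico]
  omega

/-- The run $k-1,\dots,p$ gives $k-1-p$ descents. The row ends with $p$, so one more occurs at the
junction exactly when the next letter is below $p$. -/
lemma descents_row_append {k p : ℕ} (hp : p < k) (w : List ℕ) :
    descents ((List.range k).map (rowWord k p) ++ w) =
      ((k - 1 - p) + w.head?.elim 0 fun c => if c < p then 1 else 0) + descents w := by
  cases w with
  | nil => simp [descents_row hp, descents]
  | cons c w =>
    have hrow := descents_row hp
    obtain ⟨k, rfl⟩ : ∃ j, k = j + 1 := ⟨k - 1, by omega⟩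
    have hlast : rowWord (k + 1) p k = p := by
      unfold rowWord; split_ifs <;> omega
    rw [List.range_succ, List.map_append, List.map_singleton, hlast] at hrow ⊢
    rw [List.append_assoc, List.singleton_append, descents_append_cons_cons, hrow]
    rfl

/-! ### Descent generating function of the column words -/

section Weights

variable {R : Type*} [CommRing R] (q : R)

lemma sum_compat_nil (k : ℕ) :
    ∑ p ∈ Finset.range k, q ^ (k - 1 - p) = qInt q k :=
  Finset.sum_range_reflect _ _

-- Let $c$ be the first letter of `w`. If $c<k$, only $p=c$ is excluded: $p>c$ gives the exponents
-- $1,\dots,k-1-c$ and $p<c$ gives $k-c,\dots,k-1$. If $c\ge k$, only $p=k-1$ is excluded and the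
-- exponents are $k-1-p$. Either way each of $1,\dots,k-1$ occurs once.
open scoped Classical in
lemma sum_compat (k : ℕ) {w : List ℕ} (hw : w ≠ []) :
    ∑ p ∈ Finset.range k with Compat k p w,
      q ^ ((k - 1 - p) + w.head?.elim 0 fun c => if c < p then 1 else 0) =
      q * qInt q (k - 1) := by
  obtain ⟨c, w, rfl⟩ := List.exists_cons_of_ne_nil hw
  rw [qInt, Finset.mul_sum]
  simp only [Compat, List.head?_cons, Option.mem_some_iff, forall_eq', Option.elim_some]
  -- The new index $e$ is the exponent minus one; $e+1+c<k$ singles out the exponents coming from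
  -- $p>c$.
  refine Finset.sum_nbij' (fun p => if c < p then k - 1 - p else k - 2 - p)
    (fun e => if e + 1 + c < k then k - 1 - e else k - 2 - e) ?_ ?_ ?_ ?_ ?_
  · intro p hp
    simp only [Finset.mem_filter, Finset.mem_range] at hp ⊢
    split_ifs <;> omega
  · intro e he
    simp only [Finset.mem_filter, Finset.mem_range] at he ⊢
    split_ifs <;> omega
  · intro p hp
    simp only [Finset.mem_filter, Finset.mem_range] at hp ⊢
    split_ifs <;> omega
  · intro e he
    simp only [Finset.mem_range] at he ⊢
    split_ifs <;> omega
  · intro p hp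
    simp only [Finset.mem_filter, Finset.mem_range] at hp ⊢
    rw [← pow_succ']
    congr 1
    split_ifs <;> omega

/-- The generating function by descents of the column words of a given shape. -/
lemma sum_rowLists (a : List ℕ) :
    ∑ L ∈ rowLists a, q ^ descents (colWord L) = compWeight q a := by
  classical
  induction a with
  | nil => simp [rowLists, colWord, descents, compWeight]
  | cons k a ih =>
    have hexp : ∀ y ∈ (rowLists a ×ˢ Finset.range k).filter
        (fun y => Compat k y.2 (colWord y.1)),
        q ^ descents (colWord ((k, y.2) :: y.1)) =
        q ^ ((k - 1 - y.2) + (colWord y.1).head?.elim 0 fun c => if c < y.2 then 1 else 0) *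
          q ^ descents (colWord y.1) := by
      intro y hy
      simp only [Finset.mem_filter, Finset.mem_product, Finset.mem_range] at hy
      rw [colWord, descents_row_append hy.1.2, pow_add]
    have hinj : Set.InjOn (fun y : List (ℕ × ℕ) × ℕ => (k, y.2) :: y.1)
        ((rowLists a ×ˢ Finset.range k).filter fun y => Compat k y.2 (colWord y.1)) := by
      rintro ⟨L, p⟩ _ ⟨L', p'⟩ _ h
      simp only [List.cons.injEq, Prod.mk.injEq, true_and] at h
      rw [h.1, h.2]
    have hrw : rowLists (k :: a) = ((rowLists a ×ˢ Finset.range k).filter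
        fun y => Compat k y.2 (colWord y.1)).image fun y => (k, y.2) :: y.1 := by
      ext L
      simp only [rowLists, Finset.mem_image, Finset.mem_filter]
    rw [hrw, Finset.sum_image hinj, Finset.sum_congr rfl hexp, Finset.sum_filter,
      Finset.sum_product]
    simp only [← Finset.sum_filter, ← Finset.sum_mul]
    cases a with
    | nil =>
      simp [rowLists, colWord, descents, compWeight, Compat, sum_compat_nil]
    | cons k' a =>
      rw [compWeight_cons q (List.cons_ne_nil k' a), ← ih, Finset.mul_sum]
      refine Finset.sum_congr rfl fun L hL => ?_
      rw [sum_compat q k (colWord_ne_nil hL)]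

end Weights

/-- At position $p$ the first word has $k-1$ and the second has $p$, so $k=p+1$. The next letter is
the head of `w` in the first word and at least $p+1=k$ in the second, which the second clause of
`Compat` forbids. -/
lemma row_append_eq_false {k p k' p' : ℕ} {w w' : List ℕ} (hp : p < k) (hp' : p' < k')
    (hlt : p < p') (hw : Compat k p w)
    (h : (List.range k).map (rowWord k p) ++ w = (List.range k').map (rowWord k' p') ++ w') :
    False := by
  have h1 := congrArg (·[p]?) h
  simp only [getElem?_row_append_of_lt hp, getElem?_row_append_of_lt (hlt.trans hp'),
    Option.some.injEq] at h1
  have hk : k = p + 1 := by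
    unfold rowWord at h1
    split_ifs at h1 <;> omega
  subst hk
  have h2 := congrArg (·[p + 1]?) h
  simp only [getElem?_row_append_of_lt (show p + 1 < k' by omega)] at h2
  have h3 := getElem?_row_append_add (p + 1) p 0 w
  rw [Nat.add_zero] at h3
  rw [h3, ← List.head?_eq_getElem?] at h2
  have h4 := (hw _ h2).2
  apply h4
  refine ⟨rfl, ?_⟩
  unfold rowWord
  split_ifs <;> omega

lemma colWord_injective {a a' : List ℕ} {L L' : List (ℕ × ℕ)} (hL : L ∈ rowLists a)
    (hL' : L' ∈ rowLists a') (h : colWord L = colWord L') : L = L' := by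
  induction a generalizing a' L L' with
  | nil =>
    cases a' with
    | nil => rw [mem_rowLists_nil.1 hL, mem_rowLists_nil.1 hL']
    | cons k' a' =>
      rw [mem_rowLists_nil.1 hL] at h
      exact absurd h.symm (colWord_ne_nil hL')
  | cons k a ih =>
    cases a' with
    | nil =>
      rw [mem_rowLists_nil.1 hL'] at h
      exact absurd h (colWord_ne_nil hL)
    | cons k' a' =>
      obtain ⟨p, M, rfl, hp, hM, hc⟩ := mem_rowLists_cons.1 hL
      obtain ⟨p', M', rfl, hp', hM', hc'⟩ := mem_rowLists_cons.1 hL'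
      rw [colWord, colWord] at h
      have hpp : p = p' := by
        rcases lt_trichotomy p p' with hlt | heq | hlt
        · exact (row_append_eq_false hp hp' hlt hc h).elim
        · exact heq
        · exact (row_append_eq_false hp' hp hlt hc' h.symm).elim
      subst hpp
      have h1 := congrArg (·[p]?) h
      simp only [getElem?_row_append_of_lt hp, getElem?_row_append_of_lt hp', Option.some.injEq,
        rowWord, lt_irrefl, if_false] at h1
      have hkk : k = k' := by omega
      subst hkk
      rw [ih hM hM' (List.append_cancel_left h)]

/-! ### Standard powerful arrays of the path order correspond to lists of pairs -/

/-- `A` is a standard powerful array for the path order, with row lengths `a` and with the entries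
`m, m + 1, …`. Only the values of `A` at the cells of the diagram matter. -/
structure IsPathArray (a : List ℕ) (m : ℕ) (A : ℕ → ℕ → ℕ) : Prop where
  inj : ∀ r s t u, t < a.getD r 0 → u < a.getD s 0 → A r t = A s u → r = s ∧ t = u
  bounds : ∀ r t, t < a.getD r 0 → m ≤ A r t ∧ A r t < m + a.sum
  surj : ∀ v, m ≤ v → v < m + a.sum → ∃ r t, t < a.getD r 0 ∧ A r t = v
  noDescent : ∀ r t, t + 1 < a.getD r 0 → A r t ≤ A r (t + 1) + 1
  noMin : ∀ r t, t + 1 < a.getD r 0 → ∃ u, t < u ∧ u < a.getD r 0 ∧ A r u ≤ A r t + 1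
  column : ∀ r s t, r < s → t < a.getD r 0 → t < a.getD s 0 → A r t + 1 < A s t
  last : ∀ r s u t, r < s → u + 1 = a.getD r 0 → a.getD r 0 ≤ t → t < a.getD s 0 →
    A r u + 1 < A s t

/-- Powersum words with distinct letters have the form `rowWord`, up to a shift. -/
lemma exists_eq_rowWord (k : ℕ) (w : ℕ → ℕ)
    (hinj : ∀ t u, t < k + 1 → u < k + 1 → w t = w u → t = u)
    (hdes : ∀ t, t + 1 < k + 1 → w t ≤ w (t + 1) + 1)
    (hmin : ∀ t, t + 1 < k + 1 → ∃ u, t < u ∧ u < k + 1 ∧ w u ≤ w t + 1) :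
    ∃ s p, p < k + 1 ∧ ∀ t, t < k + 1 → w t = s + rowWord (k + 1) p t := by
  induction k generalizing w with
  | zero =>
    refine ⟨w 0, 0, Nat.one_pos, fun t ht => ?_⟩
    obtain rfl : t = 0 := by omega
    simp [rowWord]
  | succ k ih =>
    obtain ⟨s, p, hp, hw⟩ := ih (fun t => w (t + 1))
      (fun t u ht hu h => by have := hinj (t + 1) (u + 1) (by omega) (by omega) h; omega)
      (fun t ht => hdes (t + 1) (by omega))
      (fun t ht => by
        obtain ⟨u, h1, h2, h3⟩ := hmin (t + 1) (by omega)
        obtain ⟨u, rfl⟩ : ∃ v, u = v + 1 := ⟨u - 1, by omega⟩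
        exact ⟨u, by omega, by omega, h3⟩)
    -- The later letters fill the interval $[s,s+k]$, so the first letter lies outside it. Not being
    -- a right-left minimum, it is at least $s-1$; not starting a descent, it is at most $s+k+1$.
    have hnot : ∀ v, v < k + 1 → w 0 ≠ s + v := by
      intro v hv h
      have h1 := hw (rowWord (k + 1) p v) (rowWord_lt hp)
      rw [rowWord_rowWord hp hv, ← h] at h1
      have := hinj _ _ (by have := rowWord_lt (t := v) hp; omega) (by omega) h1
      omega
    obtain ⟨u, hu0, hu1, hu2⟩ := hmin 0 (by omega)
    obtain ⟨u, rfl⟩ : ∃ v, u = v + 1 := ⟨u - 1, by omega⟩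
    have h1 := hw u (by omega)
    have h2 := hw 0 (by omega)
    have h3 := hdes 0 (by omega)
    simp only [Nat.zero_add] at h2 h3
    have h4 := hnot (w 0 - s)
    have h5 : rowWord (k + 1) p 0 < k + 1 := rowWord_lt hp
    by_cases hlow : w 0 + 1 = s
    · refine ⟨w 0, p + 1, by omega, fun t ht => ?_⟩
      cases t with
      | zero => simp [rowWord]
      | succ t =>
        have := hw t (by omega)
        rw [this]
        unfold rowWord
        split_ifs <;> omega
    -- A first letter above the interval must be followed by the maximum $s+k$, which forces $p=0$.
    · have hw0 : w 0 = s + (k + 1) := by omega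
      have hp0 : p = 0 := by
        have h6 : rowWord (k + 1) p 0 = k := by omega
        unfold rowWord at h6
        split_ifs at h6 <;> omega
      subst hp0
      refine ⟨s, 0, by omega, fun t ht => ?_⟩
      cases t with
      | zero => simp [rowWord, hw0]
      | succ t =>
        have := hw t (by omega)
        rw [this]
        unfold rowWord
        split_ifs <;> omega

namespace IsPathArray

variable {k m : ℕ} {a : List ℕ} {A : ℕ → ℕ → ℕ}

/-- The first row consists of the smallest entries. -/
lemma exists_first_row (h : IsPathArray (k :: a) m A) (hk : 0 < k) (ha : ∀ i ∈ a, 0 < i) :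
    ∃ p, p < k ∧ ∀ t, t < k → A 0 t = m + rowWord k p t := by
  have hrow : ∀ r, r < (k :: a).length → ∃ s p, p < (k :: a).getD r 0 ∧
      ∀ t, t < (k :: a).getD r 0 → A r t = s + rowWord ((k :: a).getD r 0) p t := by
    intro r hr
    have hpos : 0 < (k :: a).getD r 0 := by
      rw [List.getD_eq_getElem _ _ hr]
      have := List.getElem_mem hr
      rcases List.mem_cons.1 this with h1 | h1
      · rw [h1]; exact hk
      · exact ha _ h1
    obtain ⟨l, hl⟩ : ∃ l, (k :: a).getD r 0 = l + 1 := ⟨_, (Nat.sub_add_cancel hpos).symm⟩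
    rw [hl]
    refine exists_eq_rowWord l (A r) (fun t u ht hu e => (h.inj r r t u ?_ ?_ e).2) (fun t ht => ?_)
      (fun t ht => ?_)
    · rwa [hl]
    · rwa [hl]
    · exact h.noDescent r t (by rwa [hl])
    · have := h.noMin r t (by rwa [hl])
      rwa [hl] at this
  obtain ⟨s, p, hp, hs⟩ := hrow 0 (by simp)
  simp only [List.getD_cons_zero] at hp hs
  refine ⟨p, hp, ?_⟩
  suffices s = m by rwa [← this]
  have hsm : m ≤ s := by
    have h1 := hs (rowWord k p 0) (rowWord_lt hp)
    rw [rowWord_rowWord hp hk] at h1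
    have h2 := (h.bounds 0 (rowWord k p 0) (by simpa using rowWord_lt hp)).1
    omega
  refine le_antisymm ?_ hsm
  -- If the first row started at $s>m$, the row containing $m$ would reach beyond $s$, by comparison
  -- with the first row in column $0$. Being an interval, it would also contain $s$.
  by_contra! hlt
  obtain ⟨r, t, ht, hv⟩ := h.surj m le_rfl (by simp; omega)
  cases r with
  | zero =>
    have := hs t (by simpa using ht)
    omega
  | succ r =>
    have hr : r + 1 < (k :: a).length := by
      by_contra hn
      rw [List.getD_eq_default _ _ (by omega)] at ht
      omega
    obtain ⟨s', p', hp', hs'⟩ := hrow (r + 1) hr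
    have h1 := hs' t ht
    have hpos := ht
    set k' := (k :: a).getD (r + 1) 0 with hk'
    have h0 := hs' 0 (by omega)
    have hc := h.column 0 (r + 1) 0 (by omega) (by simpa) (by omega)
    have hs0 := hs 0 hk
    have hlt' : s < s' + k' := by
      have := rowWord_lt (t := 0) hp'
      omega
    have h2 := hs' (rowWord k' p' (s - s')) (rowWord_lt hp')
    rw [rowWord_rowWord hp' (by omega)] at h2
    have h3 := hs (rowWord k p 0) (rowWord_lt hp)
    rw [rowWord_rowWord hp hk] at h3
    have := h.inj 0 (r + 1) (rowWord k p 0) (rowWord k' p' (s - s'))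
      (by simpa using rowWord_lt hp) (rowWord_lt hp') (by omega)
    omega

lemma tail (h : IsPathArray (k :: a) m A) {p : ℕ} (hp : p < k)
    (hA : ∀ t, t < k → A 0 t = m + rowWord k p t) :
    IsPathArray a (m + k) fun r t => A (r + 1) t where
  inj r s t u ht hu e := by
    have := h.inj (r + 1) (s + 1) t u (by simpa using ht) (by simpa using hu) e
    omega
  bounds r t ht := by
    have hb := h.bounds (r + 1) t (by simpa using ht)
    simp only [List.sum_cons] at hb
    refine ⟨?_, by omega⟩
    by_contra! hlt
    have h1 := hA (rowWord k p (A (r + 1) t - m)) (rowWord_lt hp)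
    rw [rowWord_rowWord hp (by omega)] at h1
    have := h.inj 0 (r + 1) (rowWord k p (A (r + 1) t - m)) t (by simpa using rowWord_lt hp)
      (by simpa using ht) (by omega)
    omega
  surj v hv hv' := by
    obtain ⟨r, t, ht, e⟩ := h.surj v (by omega) (by simp only [List.sum_cons]; omega)
    cases r with
    | zero =>
      simp only [List.getD_cons_zero] at ht
      have h1 := hA t ht
      have h2 := rowWord_lt (t := t) hp
      omega
    | succ r => exact ⟨r, t, by simpa using ht, e⟩
  noDescent r t ht := h.noDescent (r + 1) t (by simpa using ht)
  noMin r t ht := by simpa using h.noMin (r + 1) t (by simpa using ht)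
  column r s t hrs ht ht' :=
    h.column (r + 1) (s + 1) t (by omega) (by simpa using ht) (by simpa using ht')
  last r s u t hrs hu ht ht' :=
    h.last (r + 1) (s + 1) u t (by omega) (by simpa using hu) (by simpa using ht)
      (by simpa using ht')

lemma exists_rowList (h : IsPathArray a m A) (ha : ∀ i ∈ a, 0 < i) :
    ∃ L ∈ rowLists a, ∀ r t, t < a.getD r 0 → (colWord L)[A r t - m]? = some t := by
  induction a generalizing m A with
  | nil => exact ⟨[], mem_rowLists_nil.2 rfl, fun r t ht => by simp at ht⟩
  | cons k a ih =>
    have hk : 0 < k := ha k (by simp)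
    have ha' : ∀ i ∈ a, 0 < i := fun i hi => ha i (by simp [hi])
    obtain ⟨p, hp, hA⟩ := h.exists_first_row hk ha'
    have htail := h.tail hp hA
    obtain ⟨L, hL, hcol⟩ := ih htail ha'
    refine ⟨(k, p) :: L, mem_rowLists_cons.2 ⟨p, L, rfl, hp, hL, ?_⟩, ?_⟩
    -- Here $c$ is the column of $m+k$, the smallest entry below the first row. Column $p$ of the
    -- first row holds its maximum $m+k-1$, so $c\ne p$. The last entry of that row is $m+p$; it is
    -- the maximum when $p+1=k$, and then $c$ cannot lie beyond the row.
    · intro c hc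
      have hsum : 0 < a.sum := by
        rw [← length_colWord hL, List.length_pos_iff]
        rintro h0
        simp [h0] at hc
      obtain ⟨r, t, ht, e⟩ := htail.surj (m + k) le_rfl (by omega)
      have h1 := hcol r t ht
      rw [e, Nat.sub_self, ← List.head?_eq_getElem?] at h1
      obtain rfl : t = c := by
        rw [Option.mem_def, h1] at hc
        exact Option.some.inj hc
      constructor
      · rintro rfl
        have h2 := h.column 0 (r + 1) t (by omega) (by simpa using hp) (by simpa using ht)
        have h3 := hA t hp
        simp only [rowWord, lt_irrefl, if_false] at h3
        omega
      · rintro ⟨rfl, hle⟩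
        have h2 := h.last 0 (r + 1) p t (by omega) (by simp) (by simpa using hle)
          (by simpa using ht)
        have h3 := hA p hp
        simp only [rowWord, lt_irrefl, if_false] at h3
        omega
    · intro r t ht
      cases r with
      | zero =>
        simp only [List.getD_cons_zero] at ht
        rw [hA t ht, Nat.add_sub_cancel_left, colWord, getElem?_row_append_of_lt (rowWord_lt hp),
          rowWord_rowWord hp ht]
      | succ r =>
        simp only [List.getD_cons_succ] at ht
        have hb := (htail.bounds r t ht).1
        rw [colWord, show A (r + 1) t - m = k + (A (r + 1) t - (m + k)) by omega,
          getElem?_row_append_add]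
        exact hcol r t ht

end IsPathArray

/-- The array with entries `m, m + 1, …` given by a list of pairs. -/
def arrayOf (m : ℕ) : List (ℕ × ℕ) → ℕ → ℕ → ℕ
  | [], _, _ => 0
  | (k, p) :: _, 0, t => m + rowWord k p t
  | (k, _) :: L, r + 1, t => arrayOf (m + k) L r t

lemma isPathArray_arrayOf {a : List ℕ} {L : List (ℕ × ℕ)} (hL : L ∈ rowLists a) (m : ℕ) :
    IsPathArray a m (arrayOf m L) ∧
      ∀ r t, t < a.getD r 0 → (colWord L)[arrayOf m L r t - m]? = some t := by
  induction a generalizing L m with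
  | nil =>
    refine ⟨⟨?_, ?_, ?_, ?_, ?_, ?_, ?_⟩, ?_⟩ <;> simp
  | cons k a ih =>
    obtain ⟨p, L, rfl, hp, hL, hc⟩ := mem_rowLists_cons.1 hL
    obtain ⟨h, hcol⟩ := ih hL (m + k)
    have hzero : ∀ t, t < k → m ≤ arrayOf m ((k, p) :: L) 0 t ∧
        arrayOf m ((k, p) :: L) 0 t < m + k := by
      intro t _
      have := rowWord_lt (t := t) hp
      simp only [arrayOf]
      omega
    have hhead : ∀ r t, t < a.getD r 0 → arrayOf (m + k) L r t = m + k →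
        t ≠ p ∧ ¬ (p + 1 = k ∧ k ≤ t) := by
      intro r t ht e
      have h1 := hcol r t ht
      rw [e, Nat.sub_self, ← List.head?_eq_getElem?] at h1
      exact hc t h1
    refine ⟨⟨?_, ?_, ?_, ?_, ?_, ?_, ?_⟩, ?_⟩
    · intro r s t u ht hu e
      rcases r with _ | r <;> rcases s with _ | s <;>
        simp only [List.getD_cons_zero, List.getD_cons_succ] at ht hu
      · simp only [arrayOf] at e
        have h1 := rowWord_rowWord hp ht
        rw [show rowWord k p t = rowWord k p u by omega, rowWord_rowWord hp hu] at h1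
        exact ⟨rfl, h1.symm⟩
      · have h1 := hzero t ht
        have h2 := h.bounds s u hu
        simp only [arrayOf] at e h1
        omega
      · have h1 := hzero u hu
        have h2 := h.bounds r t ht
        simp only [arrayOf] at e h1
        omega
      · have := h.inj r s t u ht hu e
        omega
    · intro r t ht
      rcases r with _ | r <;> simp only [List.getD_cons_zero, List.getD_cons_succ] at ht
      · have := hzero t ht
        simp only [List.sum_cons]
        omega
      · have := h.bounds r t ht
        simp only [List.sum_cons, arrayOf]
        omega
    · intro v hv hv'
      simp only [List.sum_cons] at hv'
      by_cases hlt : v < m + k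
      · refine ⟨0, rowWord k p (v - m), by simpa using rowWord_lt hp, ?_⟩
        rw [arrayOf, rowWord_rowWord hp (by omega)]
        omega
      · obtain ⟨r, t, ht, e⟩ := h.surj v (by omega) (by omega)
        exact ⟨r + 1, t, by simpa using ht, e⟩
    · intro r t ht
      rcases r with _ | r <;> simp only [List.getD_cons_zero, List.getD_cons_succ] at ht
      · simp only [arrayOf, rowWord]
        split_ifs <;> omega
      · exact h.noDescent r t ht
    · intro r t ht
      rcases r with _ | r <;> simp only [List.getD_cons_zero, List.getD_cons_succ] at ht ⊢
      · by_cases htp : t < p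
        -- In the increasing part the witness is the position of the letter $t+1$, found because
        -- `rowWord` is an involution; in the decreasing part the next position works.
        · refine ⟨rowWord k p (t + 1), ?_, rowWord_lt hp, ?_⟩
          · unfold rowWord; split_ifs <;> omega
          · simp only [arrayOf]
            rw [rowWord_rowWord hp ht]
            unfold rowWord
            split_ifs
            omega
        · refine ⟨t + 1, by omega, ht, ?_⟩
          simp only [arrayOf, rowWord]
          split_ifs <;> omega
      · exact h.noMin r t ht
    · intro r s t hrs ht ht'
      obtain ⟨s, rfl⟩ : ∃ j, s = j + 1 := ⟨s - 1, by omega⟩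
      rcases r with _ | r <;> simp only [List.getD_cons_zero, List.getD_cons_succ] at ht ht'
      · have h1 := hzero t ht
        have h2 := (h.bounds s t ht').1
        have h3 := hhead s t ht'
        -- All entries below are at least $m+k$, so the inequality can only fail for $m+k-1$ against
        -- $m+k$, the case that `Compat` excludes.
        by_contra hn
        simp only [arrayOf] at h1 hn
        have h4 := (h3 (by omega)).1
        have h5 : rowWord k p t = k - 1 := by omega
        unfold rowWord at h5
        split_ifs at h5 <;> omega
      · exact h.column r s t (by omega) ht ht'
    · intro r s u t hrs hu ht ht'
      obtain ⟨s, rfl⟩ : ∃ j, s = j + 1 := ⟨s - 1, by omega⟩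
      rcases r with _ | r <;> simp only [List.getD_cons_zero, List.getD_cons_succ] at hu ht ht'
      · have h1 := hzero u (by omega)
        have h2 := (h.bounds s t ht').1
        have h3 := hhead s t ht'
        by_contra hn
        simp only [arrayOf] at h1 hn
        have h4 := (h3 (by omega)).2
        have h5 : rowWord k p u = k - 1 := by omega
        unfold rowWord at h5
        split_ifs at h5 <;> omega
      · exact h.last r s u t (by omega) hu ht ht'
    · intro r t ht
      rcases r with _ | r <;> simp only [List.getD_cons_zero, List.getD_cons_succ] at ht
      · rw [arrayOf, Nat.add_sub_cancel_left, colWord, getElem?_row_append_of_lt (rowWord_lt hp),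
          rowWord_rowWord hp ht]
      · have hb := (h.bounds r t ht).1
        rw [arrayOf, colWord, show arrayOf (m + k) L r t - m =
          k + (arrayOf (m + k) L r t - (m + k)) by omega, getElem?_row_append_add]
        exact hcol r t ht

/-! ### Pushing columns up is a bijection of cells -/

section Push

variable {a b : List ℕ}

lemma card_filter_lt_get (a : List ℕ) (t : ℕ) :
    (Finset.univ.filter fun s : Fin a.length => t < a.get s).card = a.countP (t < ·) := by
  induction a with
  | nil => simp
  | cons k a ih =>
    rw [Finset.card_filter] at ih ⊢
    rw [List.countP_cons, ← ih]
    refine (Fin.sum_univ_succ (n := a.length)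
      fun s => if t < (k :: a).get s then 1 else 0).trans ?_
    simp [add_comm]
    rfl

lemma pushedRow_lt_countP (r : Fin a.length) {t : ℕ} (ht : t < a.get r) :
    pushedRow a r t < a.countP (t < ·) := by
  rw [← card_filter_lt_get, pushedRow]
  refine Finset.card_lt_card (Finset.ssubset_iff_of_subset ?_ |>.2 ⟨r, ?_, ?_⟩)
  · intro s hs
    simp only [Finset.mem_filter, Finset.mem_univ, true_and] at hs ⊢
    exact hs.2
  · simpa using ht
  · simp

lemma pushedRow_mono {r s : Fin a.length} (h : r.val ≤ s.val) {t u : ℕ} (htu : u ≤ t) :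
    pushedRow a r t ≤ pushedRow a s u := by
  rw [pushedRow, pushedRow]
  refine Finset.card_le_card fun x hx => ?_
  simp only [Finset.mem_filter, Finset.mem_univ, true_and] at hx ⊢
  exact ⟨by omega, by omega⟩

lemma pushedRow_strictMono {r s : Fin a.length} (h : r.val < s.val) {t : ℕ} (ht : t < a.get r) :
    pushedRow a r t < pushedRow a s t := by
  rw [pushedRow, pushedRow]
  refine Finset.card_lt_card (Finset.ssubset_iff_of_subset ?_ |>.2 ⟨r, ?_, ?_⟩)
  · intro x hx
    simp only [Finset.mem_filter, Finset.mem_univ, true_and] at hx ⊢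
    exact ⟨by omega, hx.2⟩
  · simpa using ⟨h, ht⟩
  · simp

/-- In a weakly decreasing list the entries above $t$ form an initial segment. Together with the
invariance of the count under permutation, this shows that pushed cells land in the sorted diagram.
-/
lemma lt_getElem_of_lt_countP (hb : b.Pairwise (· ≥ ·)) {i t : ℕ} (h : i < b.countP (t < ·)) :
    ∃ hi : i < b.length, t < b.get ⟨i, hi⟩ := by
  induction b generalizing i with
  | nil => simp at h
  | cons k b ih =>
    rw [List.pairwise_cons] at hb
    cases i with
    | zero =>
      refine ⟨by simp, ?_⟩
      obtain ⟨y, hy, hty⟩ := List.countP_pos_iff.1 h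
      simp only [decide_eq_true_eq] at hty
      rcases List.mem_cons.1 hy with rfl | hy
      · exact hty
      · exact lt_of_lt_of_le hty (hb.1 y hy)
    | succ i =>
      rw [List.countP_cons] at h
      obtain ⟨hi, ht⟩ := ih hb.2 (i := i) (by split_ifs at h <;> omega)
      exact ⟨by simpa using hi, by simpa using ht⟩

/-- The map of cells that pushes all columns of a diagram with row lengths `a` up. -/
def pushCell (hb : b.Pairwise (· ≥ ·)) (hab : a.Perm b) (c : DiagramCell a) : DiagramCell b :=
  have h := lt_getElem_of_lt_countP hb (hab.countP_eq _ ▸ pushedRow_lt_countP c.1 c.2.isLt)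
  ⟨⟨pushedRow a c.1 c.2, h.1⟩, ⟨c.2, h.2⟩⟩

lemma diagramCell_ext {c d : DiagramCell a} (h1 : c.1.val = d.1.val) (h2 : c.2.val = d.2.val) :
    c = d := by
  obtain ⟨r, t⟩ := c
  obtain ⟨s, u⟩ := d
  obtain rfl : r = s := Fin.ext h1
  obtain rfl : t = u := Fin.ext h2
  rfl

lemma card_diagramCell (a : List ℕ) : Fintype.card (DiagramCell a) = a.sum := by
  rw [Fintype.card_sigma]
  simp only [Fintype.card_fin]
  exact Fin.sum_univ_getElem a

lemma pushCell_bijective (hb : b.Pairwise (· ≥ ·)) (hab : a.Perm b) :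
    Function.Bijective (pushCell hb hab) := by
  rw [Fintype.bijective_iff_injective_and_card, card_diagramCell, card_diagramCell]
  refine ⟨fun c d h => ?_, hab.sum_eq⟩
  have h1 : pushedRow a c.1 c.2 = pushedRow a d.1 d.2 := congrArg (fun x => x.1.val) h
  have h2 : c.2.val = d.2.val := congrArg (fun x : DiagramCell b => x.2.val) h
  refine diagramCell_ext ?_ h2
  rcases lt_trichotomy c.1.val d.1.val with hlt | heq | hlt
  · have := pushedRow_strictMono hlt c.2.isLt
    rw [h1, h2] at this
    exact this.false.elim
  · exact heq
  · have := pushedRow_strictMono hlt d.2.isLt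
    rw [← h1, ← h2] at this
    exact this.false.elim

lemma isTab_iff {β : Type*} (hb : b.Pairwise (· ≥ ·)) (hab : a.Perm b) {A : Filling a β}
    {T : Filling b β} :
    IsTab A T ↔ ∀ c, T (pushCell hb hab c).1 (pushCell hb hab c).2 = A c.1 c.2 := by
  constructor
  · intro h c
    obtain ⟨_, _, e⟩ := h c.1 c.2
    exact e
  · exact fun h r t => ⟨_, _, h ⟨r, t⟩⟩

lemma isStandard_iff_of_isTab {β : Type*} (hb : b.Pairwise (· ≥ ·)) (hab : a.Perm b)
    {A : Filling a β} {T : Filling b β} (h : IsTab A T) : IsStandard T ↔ IsStandard A := by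
  have hcomp : (fun c : DiagramCell a => A c.1 c.2) =
      (fun c : DiagramCell b => T c.1 c.2) ∘ pushCell hb hab :=
    funext fun c => ((isTab_iff hb hab).1 h c).symm
  rw [IsStandard, IsStandard, hcomp, (pushCell_bijective hb hab).of_comp_iff]

end Push

/-! ### A standard tableau is determined by the columns of its entries -/

section Columns

variable {n : ℕ} {a : List ℕ}

open scoped Classical in
/-- The column of the entry `v` in a filling. -/
def columnOf (T : Filling a (Fin n)) (v : Fin n) : ℕ :=
  if h : ∃ c : DiagramCell a, T c.1 c.2 = v then h.choose.2.val else 0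

lemma columnOf_apply {T : Filling a (Fin n)} (hT : IsStandard T) (c : DiagramCell a) :
    columnOf T (T c.1 c.2) = c.2.val := by
  have h : ∃ d : DiagramCell a, T d.1 d.2 = T c.1 c.2 := ⟨c, rfl⟩
  rw [columnOf, dif_pos h, hT.1 h.choose_spec]

lemma tabInv_eq_descents {P : PartialOrder (Fin n)} (hpath : incGraph P = SimpleGraph.pathGraph n)
    {T : Filling a (Fin n)} (hT : IsStandard T) :
    tabInv P T = descents (List.ofFn (columnOf T)) := by
  rw [tabInv, ← card_filter_descent, hpath]
  refine Finset.card_nbij (fun p => (T p.1.1 p.1.2, T p.2.1 p.2.2)) ?_ ?_ ?_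
  · rintro ⟨c, d⟩ h
    simp only [Finset.coe_filter, Finset.mem_univ, true_and, Set.mem_ofPred_eq,
      SimpleGraph.pathGraph_adj] at h ⊢
    rw [columnOf_apply hT, columnOf_apply hT]
    exact ⟨by omega, h.2.2⟩
  · rintro ⟨c, d⟩ _ ⟨c', d'⟩ _ h
    simp only [Prod.mk.injEq] at h
    rw [hT.1 h.1, hT.1 h.2]
  · rintro ⟨v, w⟩ h
    obtain ⟨c, rfl⟩ := hT.2 v
    obtain ⟨d, rfl⟩ := hT.2 w
    simp only [Finset.coe_filter, Finset.mem_univ, true_and, Set.mem_ofPred_eq,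
      columnOf_apply hT] at h
    refine ⟨(c, d), ?_, rfl⟩
    simp only [Finset.coe_filter, Finset.mem_univ, true_and, Set.mem_ofPred_eq,
      SimpleGraph.pathGraph_adj]
    exact ⟨by omega, Or.inl h.1, h.2⟩

/-- In a standard filling with increasing columns of a left-justified diagram with weakly decreasing
row lengths, the row of an entry can be read off from the columns of all entries. -/
lemma row_eq_card (ha : a.Pairwise (· ≥ ·)) {T : Filling a (Fin n)} (hT : IsStandard T)
    (hcol : ∀ (r s : Fin a.length) (t : ℕ) (hr : t < a.get r) (hs : t < a.get s),
      r.val + 1 = s.val → (T r ⟨t, hr⟩).val < (T s ⟨t, hs⟩).val) (c : DiagramCell a) :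
    c.1.val = (Finset.univ.filter fun v : Fin n =>
      v.val < (T c.1 c.2).val ∧ columnOf T v = c.2.val).card := by
  have hlen : ∀ r s : Fin a.length, r.val ≤ s.val → a.get s ≤ a.get r := by
    intro r s h
    rcases h.eq_or_lt with h | h
    · rw [Fin.ext h]
    · exact List.pairwise_iff_get.1 ha r s h
  -- Column growth is given for adjacent rows only. It chains because row lengths decrease, so all
  -- intermediate rows also reach column $t$.
  have hlt : ∀ (k : ℕ) (r s : Fin a.length) (t : ℕ) (hr : t < a.get r) (hs : t < a.get s),
      r.val + k + 1 = s.val → (T r ⟨t, hr⟩).val < (T s ⟨t, hs⟩).val := by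
    intro k
    induction k with
    | zero => exact hcol
    | succ k ih =>
      intro r s t hr hs h
      have hs' : r.val + k + 1 < a.length := by omega
      have ht : t < a.get ⟨r.val + k + 1, hs'⟩ :=
        hs.trans_le (hlen ⟨r.val + k + 1, hs'⟩ s (by simp only; omega))
      exact (ih r ⟨r.val + k + 1, hs'⟩ t hr ht rfl).trans
        (hcol ⟨r.val + k + 1, hs'⟩ s t ht hs (by simp only; omega))
  have hlt' : ∀ (r s : Fin a.length) (t : ℕ) (hr : t < a.get r) (hs : t < a.get s),
      r.val < s.val → (T r ⟨t, hr⟩).val < (T s ⟨t, hs⟩).val := fun r s t hr hs h =>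
    hlt (s.val - r.val - 1) r s t hr hs (by omega)
  obtain ⟨r, t⟩ := c
  simp only
  have hcard : (Finset.univ.filter fun s : Fin a.length => s.val < r.val).card = r.val := by
    have := Fin.card_Iio r
    rwa [← Finset.filter_gt_eq_Iio] at this
  conv_lhs => rw [← hcard]
  refine Finset.card_bij (fun s hs => T s ⟨t.val, t.isLt.trans_le
    (hlen s r (Finset.mem_filter.1 hs).2.le)⟩) ?_ ?_ ?_
  · intro s hs
    simp only [Finset.mem_filter, Finset.mem_univ, true_and] at hs ⊢
    exact ⟨hlt' _ _ _ _ t.isLt hs, columnOf_apply hT ⟨s, ⟨t.val, _⟩⟩⟩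
  · intro s hs s' hs' h
    have := @hT.1 ⟨s, ⟨t.val, t.isLt.trans_le (hlen s r (Finset.mem_filter.1 hs).2.le)⟩⟩
      ⟨s', ⟨t.val, t.isLt.trans_le (hlen s' r (Finset.mem_filter.1 hs').2.le)⟩⟩ h
    exact congrArg Sigma.fst this
  · intro v hv
    simp only [Finset.mem_filter, Finset.mem_univ, true_and] at hv
    obtain ⟨⟨s, u⟩, rfl⟩ := hT.2 v
    have hu : u.val = t.val := (columnOf_apply hT ⟨s, u⟩).symm.trans hv.2
    obtain ⟨u, hus⟩ := u
    simp only at hu hv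
    subst hu
    have hsr : s.val < r.val := by
      by_contra! hn
      rcases hn.eq_or_lt with h | h
      · obtain rfl : r = s := Fin.ext h
        exact hv.1.false
      · exact (hv.1.trans (hlt' r s _ t.isLt hus h)).false
    exact ⟨s, by simpa using hsr, rfl⟩

lemma eq_of_columnOf_eq (ha : a.Pairwise (· ≥ ·)) {T T' : Filling a (Fin n)} (hT : IsStandard T)
    (hT' : IsStandard T')
    (hcol : ∀ (r s : Fin a.length) (t : ℕ) (hr : t < a.get r) (hs : t < a.get s),
      r.val + 1 = s.val → (T r ⟨t, hr⟩).val < (T s ⟨t, hs⟩).val)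
    (hcol' : ∀ (r s : Fin a.length) (t : ℕ) (hr : t < a.get r) (hs : t < a.get s),
      r.val + 1 = s.val → (T' r ⟨t, hr⟩).val < (T' s ⟨t, hs⟩).val)
    (h : columnOf T = columnOf T') : T = T' := by
  funext r t
  obtain ⟨d, hd⟩ := hT'.2 (T r t)
  simp only at hd
  have h2 : t.val = d.2.val := by
    rw [← columnOf_apply hT' d, hd, ← h]
    exact (columnOf_apply hT ⟨r, t⟩).symm
  have h1 : r.val = d.1.val := by
    rw [row_eq_card ha hT' hcol' d, row_eq_card ha hT hcol ⟨r, t⟩, hd, h, ← h2]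
  have h3 : (⟨r, t⟩ : DiagramCell a) = d := diagramCell_ext h1 h2
  rw [← hd, ← h3]

end Columns

/-! ### Translation between fillings and arrays indexed by natural numbers -/

lemma lt_getD_iff {a : List ℕ} {r t : ℕ} :
    t < a.getD r 0 ↔ ∃ h : r < a.length, t < a.get ⟨r, h⟩ := by
  constructor
  · intro h
    by_cases hr : r < a.length
    · rw [List.getD_eq_getElem _ _ hr] at h
      exact ⟨hr, h⟩
    · rw [List.getD_eq_default _ _ (by omega)] at h
      omega
  · rintro ⟨hr, h⟩
    rw [List.getD_eq_getElem _ _ hr]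
    exact h

lemma getD_eq_get {a : List ℕ} (r : Fin a.length) : a.getD r.val 0 = a.get r :=
  List.getD_eq_getElem _ _ r.isLt

lemma isPathArray_iff {n : ℕ} {P : PartialOrder (Fin n)}
    (hlt : ∀ i j : Fin n, P.lt i j ↔ i.val + 1 < j.val) (α : Composition n)
    (A : Filling α.blocks (Fin n)) (B : ℕ → ℕ → ℕ)
    (hAB : ∀ (r : Fin α.blocks.length) (t : Fin (α.blocks.get r)), B r t = (A r t).val) :
    IsPathArray α.blocks 0 B ↔ IsPowerfulArray P α A ∧ IsStandard A := by
  have hcell : ∀ r t, t < α.blocks.getD r 0 →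
      ∃ (h : r < α.blocks.length) (h' : t < α.blocks.get ⟨r, h⟩),
        B r t = (A ⟨r, h⟩ ⟨t, h'⟩).val := by
    intro r t ht
    obtain ⟨h, h'⟩ := lt_getD_iff.1 ht
    exact ⟨h, h', hAB ⟨r, h⟩ ⟨t, h'⟩⟩
  have hget : ∀ (r : Fin α.blocks.length) {t : ℕ}, t < α.blocks.get r → t < α.blocks.getD r 0 :=
    fun r t ht => by rwa [getD_eq_get]
  constructor
  · intro h
    refine ⟨⟨fun r => ⟨fun t ht => ?_, fun t ht => ?_⟩, fun r s t hr hs hrs => ?_,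
      fun r s u t hu hrs hle => ?_⟩, fun c d e => ?_, fun v => ?_⟩
    · have := h.noDescent r t (hget r ht)
      rw [hAB r ⟨t, Nat.lt_of_succ_lt ht⟩, hAB r ⟨t + 1, ht⟩] at this
      exact fun hn => absurd ((hlt _ _).1 hn) this.not_gt
    · by_contra hn
      have h1 : t.val + 1 < α.blocks.get r := lt_of_le_of_ne t.isLt hn
      obtain ⟨u, h2, h3, h4⟩ := h.noMin r t (hget r h1)
      rw [getD_eq_get] at h3
      rw [hAB r t, hAB r ⟨u, h3⟩] at h4
      exact absurd ((hlt _ _).1 (ht ⟨u, h3⟩ h2)) h4.not_gt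
    · have := h.column r s t hrs (hget r hr) (hget s hs)
      rw [hAB r ⟨t, hr⟩, hAB s ⟨t, hs⟩] at this
      exact (hlt _ _).2 this
    · have := h.last r s u t hrs (by rw [getD_eq_get]; exact hu) (by rw [getD_eq_get]; exact hle)
        (hget s t.isLt)
      rw [hAB r u, hAB s t] at this
      exact (hlt _ _).2 this
    · have := h.inj c.1 d.1 c.2 d.2 (hget _ c.2.isLt) (hget _ d.2.isLt)
        (by rw [hAB, hAB]; exact congrArg Fin.val e)
      exact diagramCell_ext this.1 this.2
    · obtain ⟨r, t, ht, e⟩ := h.surj v.val (Nat.zero_le _)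
        (by rw [α.blocks_sum, Nat.zero_add]; exact v.isLt)
      obtain ⟨hr, ht', e'⟩ := hcell r t ht
      exact ⟨⟨⟨r, hr⟩, ⟨t, ht'⟩⟩, Fin.ext (e'.symm.trans e)⟩
  · rintro ⟨⟨hrow, hcol, hlast⟩, hinj, hsurj⟩
    refine ⟨fun r s t u ht hu e => ?_, fun r t ht => ?_, fun v _ hv => ?_, fun r t ht => ?_,
      fun r t ht => ?_, fun r s t hrs ht hs => ?_, fun r s u t hrs hu hle ht => ?_⟩
    · obtain ⟨hr, ht', e1⟩ := hcell r t ht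
      obtain ⟨hs, hu', e2⟩ := hcell s u hu
      have h1 := @hinj ⟨⟨r, hr⟩, ⟨t, ht'⟩⟩ ⟨⟨s, hs⟩, ⟨u, hu'⟩⟩
        (Fin.ext (e1.symm.trans (e.trans e2)))
      exact ⟨congrArg (fun c : DiagramCell α.blocks => c.1.val) h1,
        congrArg (fun c : DiagramCell α.blocks => c.2.val) h1⟩
    · obtain ⟨hr, ht', e1⟩ := hcell r t ht
      rw [e1, α.blocks_sum, Nat.zero_add]
      exact ⟨Nat.zero_le _, Fin.isLt _⟩
    · rw [α.blocks_sum, Nat.zero_add] at hv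
      obtain ⟨c, hc⟩ := hsurj ⟨v, hv⟩
      exact ⟨c.1, c.2, hget _ c.2.isLt, by rw [hAB]; exact congrArg Fin.val hc⟩
    · obtain ⟨hr, ht', e1⟩ := hcell r (t + 1) ht
      obtain ⟨_, ht'', e2⟩ := hcell r t (Nat.lt_of_succ_lt ht)
      rw [e1, e2]
      by_contra! hn
      exact (hrow ⟨r, hr⟩).1 t ht' ((hlt _ _).2 hn)
    · obtain ⟨hr, ht', e1⟩ := hcell r t (Nat.lt_of_succ_lt ht)
      have h1 := mt ((hrow ⟨r, hr⟩).2 ⟨t, ht'⟩)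
        (by rw [getD_eq_get ⟨r, hr⟩] at ht; exact ht.ne)
      simp only [IsRLMin, not_forall] at h1
      obtain ⟨u, htu, hu⟩ := h1
      refine ⟨u.val, htu, hget ⟨r, hr⟩ u.isLt, ?_⟩
      rw [e1, hAB ⟨r, hr⟩ u]
      by_contra! hn
      exact hu ((hlt _ _).2 hn)
    · obtain ⟨hr, ht', e1⟩ := hcell r t ht
      obtain ⟨hs', hs'', e2⟩ := hcell s t hs
      rw [e1, e2]
      exact (hlt _ _).1 (hcol ⟨r, hr⟩ ⟨s, hs'⟩ t ht' hs'' hrs)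
    · obtain ⟨hr, hu', e1⟩ := hcell r u (by rw [← hu]; exact Nat.lt_succ_self u)
      obtain ⟨hs, ht', e2⟩ := hcell s t ht
      rw [getD_eq_get ⟨r, hr⟩] at hu hle
      rw [e1, e2]
      exact (hlt _ _).1 (hlast ⟨r, hr⟩ ⟨s, hs⟩ ⟨u, hu'⟩ ⟨t, ht'⟩ hu hrs hle)

/-! ### Powerful tableaux of the path order and their generating function -/

section Path

variable {n : ℕ} {lam : n.Partition} {α : Composition n}

lemma pairwise_rowLengths (lam : n.Partition) : (rowLengths lam).Pairwise (· ≥ ·) :=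
  Multiset.pairwise_sort _ _

lemma blocks_perm_rowLengths (h : Nat.Partition.ofComposition n α = lam) :
    α.blocks.Perm (rowLengths lam) := by
  rw [← Multiset.coe_eq_coe, rowLengths, Multiset.sort_eq, ← h]
  rfl

/-- Pushing the columns of a standard powerful array up gives a `P`-tableau. -/
lemma isPTableau_of_isTab {P : PartialOrder (Fin n)}
    (hlt : ∀ i j : Fin n, P.lt i j ↔ i.val + 1 < j.val)
    (h : Nat.Partition.ofComposition n α = lam) {A : Filling α.blocks (Fin n)}
    {T : Filling (rowLengths lam) (Fin n)} (hA : IsPowerfulArray P α A) (hT : IsTab A T) :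
    IsPTableau P lam T := by
  have hb := pairwise_rowLengths lam
  have hab := blocks_perm_rowLengths h
  rw [isTab_iff hb hab] at hT
  obtain ⟨hrow, hcol, -⟩ := hA
  have hcell : ∀ (i : Fin (rowLengths lam).length) (t : Fin ((rowLengths lam).get i)),
      ∃ (r : Fin α.blocks.length) (ht : t.val < α.blocks.get r),
        pushedRow α.blocks r t.val = i.val ∧ T i t = A r ⟨t.val, ht⟩ := by
    intro i t
    obtain ⟨⟨r, u⟩, hc⟩ := (pushCell_bijective hb hab).2 ⟨i, t⟩
    have h1 : u.val = t.val := congrArg (fun c : DiagramCell (rowLengths lam) => c.2.val) hc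
    have h2 : pushedRow α.blocks r u.val = i.val :=
      congrArg (fun c : DiagramCell (rowLengths lam) => c.1.val) hc
    have h3 := hT ⟨r, u⟩
    rw [hc] at h3
    obtain ⟨u, hu⟩ := u
    simp only at h1 h2 h3
    subst h1
    exact ⟨r, hu, h2, h3⟩
  constructor
  · intro i j t hi hj hij
    obtain ⟨r, hr, h1, e1⟩ := hcell i ⟨t, hi⟩
    obtain ⟨s, hs, h2, e2⟩ := hcell j ⟨t, hj⟩
    rw [e1, e2]
    refine hcol r s t hr hs ?_
    by_contra! hn
    have := pushedRow_mono hn (le_refl t)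
    simp only at h1 h2
    omega
  · intro i t ht
    obtain ⟨r, hr, h1, e1⟩ := hcell i ⟨t, Nat.lt_of_succ_lt ht⟩
    obtain ⟨s, hs, h2, e2⟩ := hcell i ⟨t + 1, ht⟩
    rw [e1, e2]
    simp only at h1 h2 hr hs
    have hs' : t < α.blocks.get s := Nat.lt_of_succ_lt hs
    -- The number of rows above that reach a column weakly decreases from column $t$ to $t+1$, so
    -- the right neighbor comes from the same row of `A` or a lower one.
    have hrs : r.val ≤ s.val := by
      by_contra! hn
      have h3 := pushedRow_strictMono hn hs'
      have h4 := pushedRow_mono (le_refl s.val) (Nat.le_succ t)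
      simp only [Nat.succ_eq_add_one] at h4
      omega
    have hdes := (hrow s).1 t hs
    rw [hlt] at hdes ⊢
    rcases hrs.eq_or_lt with heq | hlt'
    · obtain rfl : r = s := Fin.ext heq
      exact hdes
    -- For $r<s$, with $x=A_{r,t}$, $y=A_{s,t}$ and $z=A_{s,t+1}$: $x+1<y\le z+1$, so there is no
    -- descent from $x$ to $z$.
    · have h3 := hcol r s t hr hs' hlt'
      rw [hlt] at h3
      simp only at hdes h3 ⊢
      omega

/-- The columns of the entries of `tab(A)`, for the array `A` of a list of pairs. -/
lemma ofFn_columnOf_eq_colWord (h : Nat.Partition.ofComposition n α = lam)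
    {A : Filling α.blocks (Fin n)} {T : Filling (rowLengths lam) (Fin n)} (hT : IsTab A T)
    (hstd : IsStandard T) {L : List (ℕ × ℕ)} (hL : L ∈ rowLists α.blocks)
    (hcol : ∀ (r : Fin α.blocks.length) (t : Fin (α.blocks.get r)),
      (colWord L)[(A r t).val]? = some t.val) :
    List.ofFn (columnOf T) = colWord L := by
  have hb := pairwise_rowLengths lam
  have hab := blocks_perm_rowLengths h
  have hA := (isStandard_iff_of_isTab hb hab hT).1 hstd
  have hlen : (colWord L).length = n := (length_colWord hL).trans α.blocks_sum
  refine List.ext_getElem (by simp [hlen]) fun i hi hi' => ?_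
  rw [List.getElem_ofFn]
  obtain ⟨c, hc⟩ := hA.2 ⟨i, hlen ▸ hi'⟩
  simp only at hc
  have h1 := (isTab_iff hb hab).1 hT c
  rw [← hc, ← h1, columnOf_apply hstd]
  have h2 := hcol c.1 c.2
  rw [hc, List.getElem?_eq_getElem hi'] at h2
  exact (Option.some.inj h2).symm

variable {P : PartialOrder (Fin n)}

lemma mem_powST {T : Filling (rowLengths lam) (Fin n)} : T ∈ powST P lam ↔
    IsPTableau P lam T ∧ IsStandard T ∧ ∃ (α : Composition n) (A : Filling α.blocks (Fin n)),
      Nat.Partition.ofComposition n α = lam ∧ IsPowerfulArray P α A ∧ IsTab A T := by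
  simp only [powST, Finset.mem_filter, Finset.mem_univ, true_and]

lemma exists_rowList_of_mem_powST (hlt : ∀ i j : Fin n, P.lt i j ↔ i.val + 1 < j.val)
    {T : Filling (rowLengths lam) (Fin n)} (hT : T ∈ powST P lam) :
    ∃ α : Composition n, Nat.Partition.ofComposition n α = lam ∧
      ∃ L ∈ rowLists α.blocks, colWord L = List.ofFn (columnOf T) := by
  classical
  obtain ⟨-, hstd, α, A, hα, hA, htab⟩ := mem_powST.1 hT
  have hstdA := (isStandard_iff_of_isTab (pairwise_rowLengths lam)
    (blocks_perm_rowLengths hα) htab).1 hstd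
  let B : ℕ → ℕ → ℕ := fun r t =>
    if h : ∃ h : r < α.blocks.length, t < α.blocks.get ⟨r, h⟩ then
      (A ⟨r, h.1⟩ ⟨t, h.2⟩).val else 0
  have hAB : ∀ (r : Fin α.blocks.length) (t : Fin (α.blocks.get r)), B r t = (A r t).val :=
    fun r t => dif_pos ⟨r.isLt, t.isLt⟩
  have hB := (isPathArray_iff hlt α A B hAB).2 ⟨hA, hstdA⟩
  obtain ⟨L, hL, hcol⟩ := hB.exists_rowList fun i => α.blocks_pos
  refine ⟨α, hα, L, hL, (ofFn_columnOf_eq_colWord hα htab hstd hL fun r t => ?_).symm⟩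
  have := hcol r t (by rw [getD_eq_get]; exact t.isLt)
  rwa [hAB, Nat.sub_zero] at this

lemma exists_mem_powST_of_rowList (hlt : ∀ i j : Fin n, P.lt i j ↔ i.val + 1 < j.val)
    (hα : Nat.Partition.ofComposition n α = lam) {L : List (ℕ × ℕ)} (hL : L ∈ rowLists α.blocks) :
    ∃ T ∈ powST P lam, List.ofFn (columnOf T) = colWord L := by
  obtain ⟨hB, hcol⟩ := isPathArray_arrayOf hL 0
  have hget : ∀ (r : Fin α.blocks.length) (t : Fin (α.blocks.get r)),
      t.val < α.blocks.getD r 0 := fun r t => by rw [getD_eq_get]; exact t.isLt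
  let A : Filling α.blocks (Fin n) := fun r t => ⟨arrayOf 0 L r t, by
    have := (hB.bounds r t (hget r t)).2
    rwa [α.blocks_sum, Nat.zero_add] at this⟩
  have hA := (isPathArray_iff hlt α A (arrayOf 0 L) fun _ _ => rfl).1 hB
  have hb := pairwise_rowLengths lam
  have hab := blocks_perm_rowLengths hα
  let e := Equiv.ofBijective _ (pushCell_bijective hb hab)
  let T : Filling (rowLengths lam) (Fin n) := fun r t => A (e.symm ⟨r, t⟩).1 (e.symm ⟨r, t⟩).2
  have htab : IsTab A T := by
    rw [isTab_iff hb hab]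
    intro c
    change A (e.symm (e c)).1 (e.symm (e c)).2 = _
    rw [Equiv.symm_apply_apply]
  have hstd := (isStandard_iff_of_isTab hb hab htab).2 hA.2
  refine ⟨T, ?_, ofFn_columnOf_eq_colWord hα htab hstd hL fun r t => hcol r t (hget r t)⟩
  exact mem_powST.2 ⟨isPTableau_of_isTab hlt hα hA.1 htab, hstd, α, A, hα, hA.1, htab⟩

lemma ofFn_columnOf_injOn (hlt : ∀ i j : Fin n, P.lt i j ↔ i.val + 1 < j.val)
    (lam : n.Partition) :
    Set.InjOn (fun T : Filling (rowLengths lam) (Fin n) => List.ofFn (columnOf T))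
      (powST P lam) := by
  intro T hT T' hT' h
  rw [Finset.mem_coe, mem_powST] at hT hT'
  have hval : ∀ i j : Fin n, P.lt i j → i.val < j.val := fun i j hij =>
    (Nat.lt_succ_self _).trans ((hlt i j).1 hij)
  exact eq_of_columnOf_eq (pairwise_rowLengths lam) hT.2.1 hT'.2.1
    (fun r s t hr hs hrs => hval _ _ (hT.1.1 r s t hr hs hrs))
    (fun r s t hr hs hrs => hval _ _ (hT'.1.1 r s t hr hs hrs)) (List.ofFn_injective h)

/-- The generating function of the standard powerful tableaux by inversions. -/
lemma sum_powST (hlt : ∀ i j : Fin n, P.lt i j ↔ i.val + 1 < j.val)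
    (hpath : incGraph P = SimpleGraph.pathGraph n) (lam : n.Partition) :
    ∑ T ∈ powST P lam, (X : ℤ[X]) ^ tabInv P T =
      ∑ c : Composition n with Nat.Partition.ofComposition n c = lam,
        compWeight (X : ℤ[X]) c.blocks := by
  classical
  let S : Finset (Σ _ : Composition n, List (ℕ × ℕ)) :=
    (Finset.univ.filter fun c => Nat.Partition.ofComposition n c = lam).sigma
      fun c => rowLists c.blocks
  have hS : Set.InjOn (fun p : Σ _ : Composition n, List (ℕ × ℕ) => colWord p.2) S := by
    rintro ⟨c, L⟩ hL ⟨c', L'⟩ hL' h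
    simp only [S, Finset.coe_sigma, Set.mem_sigma_iff, Finset.mem_coe] at hL hL'
    obtain rfl := colWord_injective hL.2 hL'.2 h
    -- The column word also recovers the shape, as the first components of the pairs; hence arrays
    -- of different shapes never yield the same tableau.
    obtain rfl : c = c' := Composition.ext
      ((map_fst_of_mem_rowLists hL.2).symm.trans (map_fst_of_mem_rowLists hL'.2))
    rfl
  -- Tableaux and lists of pairs are compared through their column words: both maps to words are
  -- injective and have the same image.
  have himage : (powST P lam).image (fun T => List.ofFn (columnOf T)) =
      S.image fun p => colWord p.2 := by
    ext w
    simp only [S, Finset.mem_image, Finset.mem_sigma, Finset.mem_filter, Finset.mem_univ,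
      true_and, Sigma.exists]
    constructor
    · rintro ⟨T, hT, rfl⟩
      obtain ⟨α, hα, L, hL, e⟩ := exists_rowList_of_mem_powST hlt hT
      exact ⟨α, L, ⟨hα, hL⟩, e⟩
    · rintro ⟨α, L, ⟨hα, hL⟩, rfl⟩
      exact exists_mem_powST_of_rowList hlt hα hL
  calc ∑ T ∈ powST P lam, (X : ℤ[X]) ^ tabInv P T
      = ∑ T ∈ powST P lam, (X : ℤ[X]) ^ descents (List.ofFn (columnOf T)) := by
        refine Finset.sum_congr rfl fun T hT => ?_
        rw [tabInv_eq_descents hpath (mem_powST.1 hT).2.1]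
    _ = ∑ w ∈ (powST P lam).image (fun T => List.ofFn (columnOf T)), (X : ℤ[X]) ^ descents w := by
        rw [Finset.sum_image (ofFn_columnOf_injOn hlt lam)]
    _ = ∑ p ∈ S, (X : ℤ[X]) ^ descents (colWord p.2) := by
        rw [himage, Finset.sum_image hS]
    _ = _ := by
        rw [Finset.sum_sigma]
        exact Finset.sum_congr rfl fun c _ => sum_rowLists X c.blocks

end Path

end

theorem theorem1p9 (n : ℕ) (P : PartialOrder (Fin n)) (hP : IsNaturalUnitIntervalOrder P)
    (hpath : incGraph P = SimpleGraph.pathGraph n) :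
    (∃! c : n.Partition → ℤ[X], IsEExpansion (chromaticQSym (incGraph P)) c) ∧
    ∀ c : n.Partition → ℤ[X], IsEExpansion (chromaticQSym (incGraph P)) c →
      ∀ lam : n.Partition, c lam = ∑ T ∈ powST P lam, (X : ℤ[X]) ^ tabInv P T := by
  have hexp := isEExpansion_pathGraph n
  rw [← hpath] at hexp
  refine ⟨⟨_, hexp, fun c hc => hc.unique hexp⟩, fun c hc lam => ?_⟩
  rw [hc.unique hexp, sum_powST (path_lt_iff hP hpath) hpath]
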